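/- **Definitions.** Let $\mathcal C\subset\mathbb R^n$ be a nonempty bounded open convex set, and let $\|\cdot\|_e$ be the Euclidean norm. For distinct $p,q\in\mathcal C$, let the line through $p,q$ meet $\partial\mathcal C$ in $a,b$, in the order $a,p,q,b$. The Hilbert distance is $$d_{\mathcal C}(p,q)=\tfrac12\ln\left(\frac{\|q-a\|_e}{\|p-a\|_e}\cdot\frac{\|p-b\|_e}{\|q-b\|_e}\right),\qquad d_{\mathcal C}(p,p)=0.$$ For $p\in\mathcal C$ and $u\neq0$, let $p^{\pm}$ be the points where the rays from $p$ in the directions $\pm u$ meet $\partial\mathcal C$. Put $$\|u\|_{\mathcal C,p}=\tfrac12\|u\|_e\left(\frac1{\|p-p^+\|_e}+\frac1{\|p-p^-\|_e}\right),\qquad \|0\|_{\mathcal C,p}=0,$$ and $\|l\|^*_{\mathcal C,p}=\sup\{l(u):\|u\|_{\mathcal C,p}=1\}$ for linear forms $l$. The Hilbert (Busemann) measure $\mu_{\mathcal C}$ on $\mathcal C$ has Lebesgue density $p\mapsto\omega_n/\mathrm{vol}_e\{u:\|u\|_{\mathcal C,p}<1\}$, where $\omega_n$ is the volume of the Euclidean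 unit ball of $\mathbb R^n$. The bottom of the spectrum is $$\lambda_1(\mathcal C)=\inf_f\frac{\int_{\mathcal C}(\|df_p\|^*_{\mathcal C,p})^2\,d\mu_{\mathcal C}(p)}{\int_{\mathcal C}f^2\,d\mu_{\mathcal C}},$$ the infimum being over all nonzero Lipschitz functions $f$ with compact support in $\mathcal C$. The Cheeger constant is $$I^\infty(\mathcal C)=\inf_U\frac{\nu_{\mathcal C}(\partial U)}{\mu_{\mathcal C}(U)},$$ the infimum being over all nonempty open sets $U$ with compact closure contained in $\mathcal C$ and with $\partial U$ a $C^1$ submanifold of dimension $n-1$; here $\nu_{\mathcal C}$ is the $(n-1)$-dimensional Hausdorff measure of $d_{\mathcal C}$, normalized by the factor $\omega_{n-1}/2^{n-1}$. The space $(\mathcal C,d_{\mathcal C})$ is Gromov-hyperbolic if for some $\delta>0$ and all $w,x,y,z\in\mathcal C$ one has $(x|z)_w\ge\min\{(x|y)_w,(y|z)_w\}-\delta$, where $(x|y)_w=\tfrac12\left(d_{\mathcal C}(x,w)+d_{\mathcal C}(y,w)-d_{\mathcal C}(x,y)\right)$. **Proposition 4.1.** Let $\mathcal C=\{(x,y,z)\in\mathbb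 R^3: x^2+y^2<1,\ |z|<1\}$ be the cylinder of height $2$ over the unit disk; it is a nonempty bounded open convex set. Then $I^\infty(\mathcal C)>0$ and $\lambda_1(\mathcal C)>0$. However, $\mathcal C$ is not strictly convex (its closure is not a strictly convex set), and $(\mathcal C,d_{\mathcal C})$ is not Gromov-hyperbolic. Consequently, for nonempty bounded open convex sets in $\mathbb R^3$, neither $\lambda_1>0$ nor $I^\infty>0$ implies Gromov-hyperbolicity of the Hilbert geometry. -/

import Mathlib

open scoped ENNReal NNReal

noncomputable section

namespace HilbertGeometry

/-- Domains carrying a Hilbert geometry: nonempty bounded open convex subsets of `ℝⁿ`. -/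
structure IsHilbertDomain {n : ℕ} (C : Set (EuclideanSpace ℝ (Fin n))) : Prop where
  nonempty : C.Nonempty
  isOpen : IsOpen C
  convex : Convex ℝ C
  bounded : Bornology.IsBounded C

/-- The point at which the ray from `p ∈ C` in the direction `u ≠ 0` meets the boundary of the
bounded convex open set `C`. -/
def exitPoint {n : ℕ} (C : Set (EuclideanSpace ℝ (Fin n))) (p u : EuclideanSpace ℝ (Fin n)) :
    EuclideanSpace ℝ (Fin n) :=
  p + sSup {t : ℝ | 0 ≤ t ∧ p + t • u ∈ C} • u

open Classical in
/-- The Hilbert distance `(1/2) log [a, p, q, b]`, where the line through `p ≠ q` meets the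
boundary of `C` in `a` and `b`, in the order `a, p, q, b`. -/
def hilbertDist {n : ℕ} (C : Set (EuclideanSpace ℝ (Fin n))) (p q : EuclideanSpace ℝ (Fin n)) :
    ℝ :=
  if p = q then 0
  else
    (1 / 2) * Real.log
      ((‖q - exitPoint C p (p - q)‖ / ‖p - exitPoint C p (p - q)‖) *
        (‖p - exitPoint C q (q - p)‖ / ‖q - exitPoint C q (q - p)‖))

/-- The Finsler norm at `p ∈ C` of the tangent vector `u` (it is `0` for `u = 0`). -/
def finslerNorm {n : ℕ} (C : Set (EuclideanSpace ℝ (Fin n))) (p u : EuclideanSpace ℝ (Fin n)) :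
    ℝ :=
  (1 / 2) * ‖u‖ * (1 / ‖p - exitPoint C p u‖ + 1 / ‖p - exitPoint C p (-u)‖)

/-- The dual norm of a linear form on the tangent space at `p`. -/
def dualNorm {n : ℕ} (C : Set (EuclideanSpace ℝ (Fin n))) (p : EuclideanSpace ℝ (Fin n))
    (l : EuclideanSpace ℝ (Fin n) →L[ℝ] ℝ) : ℝ :=
  sSup {r : ℝ | ∃ u : EuclideanSpace ℝ (Fin n), finslerNorm C p u = 1 ∧ l u = r}

/-- The open unit ball of the tangent space at `p`. -/
def tangentBall {n : ℕ} (C : Set (EuclideanSpace ℝ (Fin n))) (p : EuclideanSpace ℝ (Fin n)) :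
    Set (EuclideanSpace ℝ (Fin n)) :=
  {u | finslerNorm C p u < 1}

/-- The volume `ω_n` of the Euclidean unit ball of `ℝⁿ`. -/
def unitBallVolume (n : ℕ) : ℝ≥0∞ :=
  MeasureTheory.volume (Metric.ball (0 : EuclideanSpace ℝ (Fin n)) 1)

/-- The Hilbert (Busemann) measure of `C`: density `ω_n / vol (TB_C p)` with respect to Lebesgue
measure on `C`. -/
def hilbertMeasure {n : ℕ} (C : Set (EuclideanSpace ℝ (Fin n))) :
    MeasureTheory.Measure (EuclideanSpace ℝ (Fin n)) :=
  (MeasureTheory.volume.restrict C).withDensity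
    fun p => unitBallVolume n / MeasureTheory.volume (tangentBall C p)

/-- The Rayleigh quotient of `f`. -/
def rayleighQuotient {n : ℕ} (C : Set (EuclideanSpace ℝ (Fin n)))
    (f : EuclideanSpace ℝ (Fin n) → ℝ) : ℝ≥0∞ :=
  (∫⁻ p, ENNReal.ofReal (dualNorm C p (fderiv ℝ f p) ^ 2) ∂(hilbertMeasure C)) /
    (∫⁻ p, ENNReal.ofReal (f p ^ 2) ∂(hilbertMeasure C))

/-- Nonzero Lipschitz functions with compact support contained in `C` (extended by zero). -/
structure IsTestFunction {n : ℕ} (C : Set (EuclideanSpace ℝ (Fin n)))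
    (f : EuclideanSpace ℝ (Fin n) → ℝ) : Prop where
  lipschitz : ∃ K : ℝ≥0, LipschitzWith K f
  compactSupport : HasCompactSupport f
  support_subset : tsupport f ⊆ C
  ne_zero : f ≠ 0

/-- The bottom of the spectrum `λ₁(C)`. -/
def bottomOfSpectrum {n : ℕ} (C : Set (EuclideanSpace ℝ (Fin n))) : ℝ≥0∞ :=
  ⨅ (f : EuclideanSpace ℝ (Fin n) → ℝ) (_ : IsTestFunction C f), rayleighQuotient C f

/-- The diameter of a subset of `C` for the Hilbert distance. -/
def hilbertDiam {n : ℕ} (C : Set (EuclideanSpace ℝ (Fin n)))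
    (A : Set (EuclideanSpace ℝ (Fin n))) : ℝ≥0∞ :=
  ⨆ (x ∈ A) (y ∈ A), ENNReal.ofReal (hilbertDist C x y)

/-- The `k`-dimensional Hausdorff measure, for the Hilbert distance, of a subset `A` of `C`, with
the usual normalization `ω_k / 2 ^ k` (it is the one for which Hausdorff measure agrees with the
volume of Euclidean spaces). -/
def hilbertHausdorff {n : ℕ} (C : Set (EuclideanSpace ℝ (Fin n))) (k : ℕ)
    (A : Set (EuclideanSpace ℝ (Fin n))) : ℝ≥0∞ :=
  (unitBallVolume k / 2 ^ k) *
    ⨆ (r : ℝ≥0∞) (_ : 0 < r),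
      ⨅ (t : ℕ → Set (EuclideanSpace ℝ (Fin n)))
        (_ : (∀ i, t i ⊆ C) ∧ A ⊆ ⋃ i, t i ∧ ∀ i, hilbertDiam C (t i) ≤ r),
        ∑' i, ⨆ (_ : (t i).Nonempty), hilbertDiam C (t i) ^ k

/-- `S` is an embedded `C¹` submanifold of codimension one of `ℝⁿ`: locally it is the zero set of
a `C¹` function with nonvanishing differential. -/
def IsHypersurface {n : ℕ} (S : Set (EuclideanSpace ℝ (Fin n))) : Prop :=
  ∀ p ∈ S, ∃ (V : Set (EuclideanSpace ℝ (Fin n))) (g : EuclideanSpace ℝ (Fin n) → ℝ),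
    IsOpen V ∧ p ∈ V ∧ ContDiffOn ℝ 1 g V ∧ (∀ x ∈ V, fderiv ℝ g x ≠ 0) ∧
      S ∩ V = {x ∈ V | g x = 0}

/-- Nonempty open sets with compact closure in `C` whose boundary is a hypersurface. -/
structure IsCheegerDomain {n : ℕ} (C U : Set (EuclideanSpace ℝ (Fin n))) : Prop where
  nonempty : U.Nonempty
  isOpen : IsOpen U
  compact_closure : IsCompact (closure U)
  closure_subset : closure U ⊆ C
  hypersurface : IsHypersurface (frontier U)

/-- The Cheeger constant `I^∞(C)`. -/
def cheegerConstant {n : ℕ} (C : Set (EuclideanSpace ℝ (Fin n))) : ℝ≥0∞ :=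
  ⨅ (U : Set (EuclideanSpace ℝ (Fin n))) (_ : IsCheegerDomain C U),
    hilbertHausdorff C (n - 1) (frontier U) / hilbertMeasure C U

/-- The Gromov product `(x | y)_w` for the Hilbert distance. -/
def gromovProduct {n : ℕ} (C : Set (EuclideanSpace ℝ (Fin n)))
    (w x y : EuclideanSpace ℝ (Fin n)) : ℝ :=
  (1 / 2) * (hilbertDist C x w + hilbertDist C y w - hilbertDist C x y)

/-- `(C, d_C)` is hyperbolic in the sense of Gromov. -/
def IsGromovHyperbolic {n : ℕ} (C : Set (EuclideanSpace ℝ (Fin n))) : Prop :=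
  ∃ δ : ℝ, 0 < δ ∧ ∀ w ∈ C, ∀ x ∈ C, ∀ y ∈ C, ∀ z ∈ C,
    min (gromovProduct C w x y) (gromovProduct C w y z) - δ ≤ gromovProduct C w x z

/-- The open cylinder of height `2` over the unit disk. -/
def cylinder : Set (EuclideanSpace ℝ (Fin 3)) :=
  {x | x 0 ^ 2 + x 1 ^ 2 < 1 ∧ |x 2| < 1}

end HilbertGeometry

end

noncomputable section

namespace HilbertGeometry

open MeasureTheory

/-! ### Exit times, the Finsler norm and its dual on a general Hilbert domain. -/

section General

variable {n : ℕ} {C : Set (EuclideanSpace ℝ (Fin n))}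

/-! The cylinder is the product of a disk, whose Hilbert geometry is the Klein model of the
hyperbolic plane, and an interval, whose Hilbert geometry is a line. The hyperbolic factor produces
the spectral gap and the isoperimetric inequality; the product structure destroys hyperbolicity.

For the gap, everything is compared with the product. In suitable linear coordinates the tangent
ball at `p` lies between cubes of half-sides 1/8 and 1 (`finslerNorm_le_half`,
`tangentBall_subset_normalizedCube`), so the Busemann measure is within constant factors of
`productMeasure`, of density `productWeight`. This density has the explicit primitive `flux` along
the first axis (`hasLineDerivAt_flux`), with `|flux| ≤ fluxBound`. In other words, the field `(flux
/ productWeight) • e₀` has divergence one for `productMeasure`, and its Finsler norm is at most 4,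
by `abs_flux_le` and `finslerNorm_single_le`. A bounded field of divergence one forces both
constants to be positive.

For the spectrum, integrating `f ^ 2` against the divergence by parts and absorbing one term gives
the Hardy inequality `lintegral_sq_le`. For the Cheeger constant, the fundamental theorem of
calculus on each line parallel to the first axis bounds the mass of `U` on that line by `fluxBound`
at two boundary points. A boundary piece of small Hilbert diameter `d` projects into a rectangle
whose area times `fluxBound` is at most a multiple of `d ^ 2` (`exists_majorant_of_hilbertDiam_le`),
so summing over a cover compares the mass with the Hausdorff measure directly.

Hyperbolicity fails already in the slice `y = 0`, a square: four vertices of a smaller square, one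
of them the center, violate the four-point inequality as the opposite vertex tends to a corner. -/

/-- The time at which the ray from `p` with velocity `u` leaves `C`. -/
def exitTime (C : Set (EuclideanSpace ℝ (Fin n))) (p u : EuclideanSpace ℝ (Fin n)) : ℝ :=
  sSup {t : ℝ | 0 ≤ t ∧ p + t • u ∈ C}

lemma exitPoint_eq (p u : EuclideanSpace ℝ (Fin n)) :
    exitPoint C p u = p + exitTime C p u • u := rfl

lemma bddAbove_exitTimes (hC : IsHilbertDomain C) (p : EuclideanSpace ℝ (Fin n))
    {u : EuclideanSpace ℝ (Fin n)} (hu : u ≠ 0) :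
    BddAbove {t : ℝ | 0 ≤ t ∧ p + t • u ∈ C} := by
  obtain ⟨R, hR⟩ := hC.bounded.subset_closedBall p
  refine ⟨R / ‖u‖, fun t ht => ?_⟩
  have h1 := hR ht.2
  rw [Metric.mem_closedBall, dist_eq_norm, add_sub_cancel_left, norm_smul, Real.norm_eq_abs,
    abs_of_nonneg ht.1] at h1
  rwa [le_div_iff₀ (norm_pos_iff.2 hu)]

lemma le_exitTime (hC : IsHilbertDomain C) {p u : EuclideanSpace ℝ (Fin n)} (hu : u ≠ 0)
    {t : ℝ} (ht : 0 ≤ t) (hp : p + t • u ∈ C) : t ≤ exitTime C p u :=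
  le_csSup (bddAbove_exitTimes hC p hu) ⟨ht, hp⟩

lemma exitTime_pos (hC : IsHilbertDomain C) {p u : EuclideanSpace ℝ (Fin n)} (hp : p ∈ C)
    (hu : u ≠ 0) : 0 < exitTime C p u := by
  have hc : Continuous fun t : ℝ => p + t • u := by fun_prop
  have h0 : (fun t : ℝ => p + t • u) ⁻¹' C ∈ nhds (0 : ℝ) :=
    hc.continuousAt.preimage_mem_nhds (by simpa using hC.isOpen.mem_nhds hp)
  obtain ⟨ε, hε, hb⟩ := Metric.mem_nhds_iff.1 h0
  refine lt_of_lt_of_le (half_pos hε) (le_exitTime hC hu (half_pos hε).le (hb ?_))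
  rw [Metric.mem_ball, Real.dist_eq, sub_zero, abs_of_pos (half_pos hε)]
  exact half_lt_self hε

lemma exitPoint_mem_closure (hC : IsHilbertDomain C) {p u : EuclideanSpace ℝ (Fin n)}
    (hp : p ∈ C) (hu : u ≠ 0) : p + exitTime C p u • u ∈ closure C := by
  have hc : Continuous fun t : ℝ => p + t • u := by fun_prop
  have h := csSup_mem_closure (s := {t : ℝ | 0 ≤ t ∧ p + t • u ∈ C})
    ⟨0, le_rfl, by simpa using hp⟩ (bddAbove_exitTimes hC p hu)
  exact map_mem_closure (f := fun t : ℝ => p + t • u) hc h fun t ht => ht.2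

lemma exitTime_eq {p u : EuclideanSpace ℝ (Fin n)} {T : ℝ} (hT : 0 < T)
    (h : ∀ t, 0 ≤ t → (p + t • u ∈ C ↔ t < T)) : exitTime C p u = T := by
  have : {t : ℝ | 0 ≤ t ∧ p + t • u ∈ C} = Set.Ico 0 T := by
    ext t
    exact ⟨fun ht => ⟨ht.1, (h t ht.1).1 ht.2⟩, fun ht => ⟨ht.1, (h t ht.1).2 ht.2⟩⟩
  rw [exitTime, this, csSup_Ico hT]

/-- All points involved are collinear, so the Euclidean ratios reduce to ratios of parameters in
units of `p - q`. -/
lemma hilbertDist_eq {p q : EuclideanSpace ℝ (Fin n)} (hpq : p ≠ q) {σ τ : ℝ} (hσ : 0 < σ)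
    (hτ : 0 < τ) (h1 : exitTime C p (p - q) = σ) (h2 : exitTime C q (q - p) = τ) :
    hilbertDist C p q = 1 / 2 * Real.log ((1 + σ⁻¹) * (1 + τ⁻¹)) := by
  have aux : ∀ {a b : EuclideanSpace ℝ (Fin n)} {s : ℝ}, a ≠ b → 0 < s →
      ‖b - (a + s • (a - b))‖ / ‖a - (a + s • (a - b))‖ = 1 + s⁻¹ := by
    intro a b s hab hs
    have e1 : b - (a + s • (a - b)) = -((1 + s) • (a - b)) := by module
    have e2 : a - (a + s • (a - b)) = -(s • (a - b)) := by module
    have : ‖a - b‖ ≠ 0 := norm_ne_zero_iff.2 (sub_ne_zero.2 hab)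
    rw [e1, e2, norm_neg, norm_neg, norm_smul, norm_smul, Real.norm_eq_abs, Real.norm_eq_abs,
      abs_of_pos hs, abs_of_pos (by linarith)]
    field_simp
    ring
  rw [hilbertDist, if_neg hpq, exitPoint_eq, exitPoint_eq, h1, h2, aux hpq hσ, aux hpq.symm hτ]

lemma exists_exitTimes (hC : IsHilbertDomain C) {p q : EuclideanSpace ℝ (Fin n)} (hp : p ∈ C)
    (hq : q ∈ C) (hpq : p ≠ q) : ∃ σ τ : ℝ, 0 < σ ∧ 0 < τ ∧
      p + σ • (p - q) ∈ closure C ∧ q + τ • (q - p) ∈ closure C ∧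
      hilbertDist C p q = 1 / 2 * Real.log ((1 + σ⁻¹) * (1 + τ⁻¹)) :=
  ⟨_, _, exitTime_pos hC hp (sub_ne_zero.2 hpq), exitTime_pos hC hq (sub_ne_zero.2 hpq.symm),
    exitPoint_mem_closure hC hp (sub_ne_zero.2 hpq),
    exitPoint_mem_closure hC hq (sub_ne_zero.2 hpq.symm),
    hilbertDist_eq hpq (exitTime_pos hC hp (sub_ne_zero.2 hpq))
      (exitTime_pos hC hq (sub_ne_zero.2 hpq.symm)) rfl rfl⟩

/-- A nonnegative concave function decreases at most exponentially for the Hilbert distance. -/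
lemma concaveOn_le_exp_mul (hC : IsHilbertDomain C) {g : EuclideanSpace ℝ (Fin n) → ℝ}
    (hg : ConcaveOn ℝ (closure C) g) (h0 : ∀ x ∈ closure C, 0 ≤ g x)
    {p q : EuclideanSpace ℝ (Fin n)} (hp : p ∈ C) (hq : q ∈ C) :
    g p ≤ Real.exp (2 * hilbertDist C p q) * g q := by
  rcases eq_or_ne p q with rfl | hpq
  · simp [hilbertDist]
  obtain ⟨σ, τ, hσ, hτ, -, h2, hd⟩ := exists_exitTimes hC hp hq hpq
  have hconv := hg.2 (subset_closure hp) h2 (show 0 ≤ τ / (1 + τ) by positivity)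
    (show 0 ≤ 1 / (1 + τ) by positivity) (by field_simp; ring)
  -- `q` lies between `p` and the exit point beyond `q`; concavity along this segment, with the
  -- value at the exit point discarded, gives the factor `1 + τ⁻¹`.
  have e : (τ / (1 + τ)) • p + (1 / (1 + τ)) • (q + τ • (q - p)) = q := by
    match_scalars <;> field_simp; ring
  rw [e] at hconv
  have h3 := h0 _ h2
  have hgq := h0 _ (subset_closure hq)
  simp only [smul_eq_mul] at hconv
  have h4 : g p ≤ (1 + τ⁻¹) * g q := by
    have : τ / (1 + τ) * g p ≤ g q := by
      have : 0 ≤ 1 / (1 + τ) * g (q + τ • (q - p)) := by positivity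
      linarith
    rw [div_mul_eq_mul_div, div_le_iff₀ (by positivity)] at this
    calc g p = τ⁻¹ * (τ * g p) := by field_simp
      _ ≤ τ⁻¹ * (g q * (1 + τ)) := by gcongr
      _ = _ := by field_simp; ring
  have h5 : Real.exp (2 * hilbertDist C p q) = (1 + σ⁻¹) * (1 + τ⁻¹) := by
    rw [hd, ← mul_assoc]; norm_num
    rw [Real.exp_log (by positivity)]
  rw [h5]
  refine h4.trans (mul_le_mul_of_nonneg_right ?_ hgq)
  have : 0 < σ⁻¹ := by positivity
  have : 0 < τ⁻¹ := by positivity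
  nlinarith

lemma finslerNorm_eq (hC : IsHilbertDomain C) {p u : EuclideanSpace ℝ (Fin n)} (hp : p ∈ C)
    (hu : u ≠ 0) :
    finslerNorm C p u = 1 / 2 * ((exitTime C p u)⁻¹ + (exitTime C p (-u))⁻¹) := by
  have h1 := exitTime_pos hC hp hu
  have h2 := exitTime_pos hC hp (neg_ne_zero.2 hu)
  have h3 : ‖u‖ ≠ 0 := norm_ne_zero_iff.2 hu
  have aux : ∀ {v : EuclideanSpace ℝ (Fin n)}, 0 < exitTime C p v →
      ‖p - exitPoint C p v‖ = exitTime C p v * ‖v‖ := by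
    intro v hv
    rw [exitPoint_eq, sub_add_cancel_left, norm_neg, norm_smul, Real.norm_eq_abs, abs_of_pos hv]
  rw [finslerNorm, aux h1, aux h2, norm_neg]
  field_simp

lemma finslerNorm_zero (p : EuclideanSpace ℝ (Fin n)) : finslerNorm C p 0 = 0 := by
  simp [finslerNorm]

/-- If both rays survive up to time `T`, both exit times are at least `T`. -/
lemma finslerNorm_le_inv (hC : IsHilbertDomain C) {p u : EuclideanSpace ℝ (Fin n)} (hp : p ∈ C)
    {T : ℝ} (hT : 0 < T) (h1 : p + T • u ∈ C) (h2 : p - T • u ∈ C) :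
    finslerNorm C p u ≤ T⁻¹ := by
  rcases eq_or_ne u 0 with rfl | hu
  · rw [finslerNorm_zero]; positivity
  have e1 := le_exitTime hC hu hT.le h1
  have e2 := le_exitTime hC (neg_ne_zero.2 hu) (p := p) hT.le (by
    rwa [smul_neg, ← sub_eq_add_neg])
  rw [finslerNorm_eq hC hp hu]
  have := inv_anti₀ hT e1
  have := inv_anti₀ hT e2
  linarith

open scoped Pointwise in
lemma exitTime_smul {p u : EuclideanSpace ℝ (Fin n)} {c : ℝ} (hc : 0 < c) :
    exitTime C p (c • u) = c⁻¹ * exitTime C p u := by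
  have : {t : ℝ | 0 ≤ t ∧ p + t • c • u ∈ C} = c⁻¹ • {t : ℝ | 0 ≤ t ∧ p + t • u ∈ C} := by
    ext t
    rw [Set.mem_smul_set_iff_inv_smul_mem₀ (inv_ne_zero hc.ne'), inv_inv, smul_eq_mul]
    simp only [Set.mem_ofPred_eq, smul_smul, mul_comm c t]
    rw [mul_nonneg_iff_of_pos_right hc]
  rw [exitTime, this, Real.sSup_smul_of_nonneg (by positivity), smul_eq_mul, exitTime]

lemma finslerNorm_smul (hC : IsHilbertDomain C) {p u : EuclideanSpace ℝ (Fin n)} (hp : p ∈ C)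
    {c : ℝ} (hc : 0 < c) : finslerNorm C p (c • u) = c * finslerNorm C p u := by
  rcases eq_or_ne u 0 with rfl | hu
  · simp [finslerNorm_zero]
  rw [finslerNorm_eq hC hp hu, finslerNorm_eq hC hp (smul_ne_zero hc.ne' hu), ← smul_neg,
    exitTime_smul hc, exitTime_smul hc, mul_inv, mul_inv, inv_inv]
  ring

lemma finslerNorm_pos (hC : IsHilbertDomain C) {p u : EuclideanSpace ℝ (Fin n)} (hp : p ∈ C)
    (hu : u ≠ 0) : 0 < finslerNorm C p u := by
  have h1 := exitTime_pos hC hp hu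
  have h2 := exitTime_pos hC hp (neg_ne_zero.2 hu)
  rw [finslerNorm_eq hC hp hu]
  positivity

/-- A unit tangent vector is no longer than the radius `R` of a ball around `p` containing the
domain. Boundedness is essential because a real `sSup` of an unbounded set is 0. -/
lemma bddAbove_dualNorm (hC : IsHilbertDomain C) {p : EuclideanSpace ℝ (Fin n)} (hp : p ∈ C)
    (l : EuclideanSpace ℝ (Fin n) →L[ℝ] ℝ) :
    BddAbove {r : ℝ | ∃ u : EuclideanSpace ℝ (Fin n), finslerNorm C p u = 1 ∧ l u = r} := by
  obtain ⟨R, hR⟩ := hC.bounded.closure.subset_closedBall p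
  refine ⟨‖l‖ * R, ?_⟩
  rintro r ⟨u, hu, rfl⟩
  have hu0 : u ≠ 0 := by
    rintro rfl
    simp [finslerNorm_zero] at hu
  refine (le_abs_self _).trans ((l.le_opNorm u).trans ?_)
  gcongr
  have aux : ∀ {v : EuclideanSpace ℝ (Fin n)}, v ≠ 0 → exitTime C p v * ‖v‖ ≤ R := by
    intro v hv
    have := hR (exitPoint_mem_closure hC hp hv)
    rwa [Metric.mem_closedBall, dist_eq_norm, add_sub_cancel_left, norm_smul, Real.norm_eq_abs,
      abs_of_pos (exitTime_pos hC hp hv)] at this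
  have h1 := exitTime_pos hC hp hu0
  have h2 := exitTime_pos hC hp (neg_ne_zero.2 hu0)
  have h3 := aux hu0
  have h4 := aux (neg_ne_zero.2 hu0)
  rw [norm_neg] at h4
  have hn := norm_pos_iff.2 hu0
  rw [finslerNorm_eq hC hp hu0] at hu
  have hRpos : 0 < R := lt_of_lt_of_le (by positivity) h3
  have h5 : ‖u‖ / R ≤ (exitTime C p u)⁻¹ := by
    rw [div_le_iff₀ hRpos, inv_mul_eq_div, le_div_iff₀ h1]; linarith
  have h6 : ‖u‖ / R ≤ (exitTime C p (-u))⁻¹ := by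
    rw [div_le_iff₀ hRpos, inv_mul_eq_div, le_div_iff₀ h2]; linarith
  have : ‖u‖ / R ≤ 1 := by linarith
  rwa [div_le_one hRpos] at this

lemma le_dualNorm_mul (hC : IsHilbertDomain C) {p : EuclideanSpace ℝ (Fin n)} (hp : p ∈ C)
    (l : EuclideanSpace ℝ (Fin n) →L[ℝ] ℝ) {u : EuclideanSpace ℝ (Fin n)} (hu : u ≠ 0) :
    l u ≤ dualNorm C p l * finslerNorm C p u := by
  have hF := finslerNorm_pos hC hp hu
  have : l ((finslerNorm C p u)⁻¹ • u) ≤ dualNorm C p l := by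
    refine le_csSup (bddAbove_dualNorm hC hp l) ⟨_, ?_, rfl⟩
    rw [finslerNorm_smul hC hp (by positivity), inv_mul_cancel₀ hF.ne']
  rw [map_smul, smul_eq_mul, inv_mul_eq_div, div_le_iff₀ hF] at this
  exact this

lemma finslerNorm_neg (p u : EuclideanSpace ℝ (Fin n)) :
    finslerNorm C p (-u) = finslerNorm C p u := by
  simp only [finslerNorm, norm_neg, neg_neg]
  ring

lemma abs_le_dualNorm_mul (hC : IsHilbertDomain C) {p : EuclideanSpace ℝ (Fin n)} (hp : p ∈ C)
    (l : EuclideanSpace ℝ (Fin n) →L[ℝ] ℝ) {u : EuclideanSpace ℝ (Fin n)} (hu : u ≠ 0) :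
    |l u| ≤ dualNorm C p l * finslerNorm C p u := by
  refine abs_le'.2 ⟨le_dualNorm_mul hC hp l hu, ?_⟩
  have := le_dualNorm_mul hC hp l (neg_ne_zero.2 hu)
  rwa [map_neg, finslerNorm_neg] at this

end General

/-! ### The cylinder as a convex domain. -/

section Cylinder

lemma isOpen_cylinder : IsOpen cylinder := by
  have h1 : Continuous fun x : EuclideanSpace ℝ (Fin 3) => x 0 ^ 2 + x 1 ^ 2 := by fun_prop
  have h2 : Continuous fun x : EuclideanSpace ℝ (Fin 3) => |x 2| := by fun_prop
  exact (isOpen_lt h1 continuous_const).inter (isOpen_lt h2 continuous_const)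

lemma sq_add_sq_convex {a b s t u v : ℝ} (ha : 0 ≤ a) (hb : 0 ≤ b) (hab : a + b = 1) :
    (a * s + b * u) ^ 2 + (a * t + b * v) ^ 2 ≤ a * (s ^ 2 + t ^ 2) + b * (u ^ 2 + v ^ 2) := by
  obtain rfl : b = 1 - a := by linarith
  nlinarith [mul_nonneg (mul_nonneg ha hb) (add_nonneg (sq_nonneg (s - u)) (sq_nonneg (t - v)))]

lemma convex_cylinder : Convex ℝ cylinder := by
  intro x hx y hy a b ha hb hab
  have hz : Convex ℝ (Set.Ioo (-1 : ℝ) 1) := convex_Ioo _ _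
  refine ⟨?_, abs_lt.2 (hz (abs_lt.1 hx.2) (abs_lt.1 hy.2) ha hb hab)⟩
  have hr : Convex ℝ (Set.Iio (1 : ℝ)) := convex_Iio _
  exact lt_of_le_of_lt (sq_add_sq_convex ha hb hab) (hr hx.1 hy.1 ha hb hab)

lemma closure_cylinder_subset :
    closure cylinder ⊆ {x | x 0 ^ 2 + x 1 ^ 2 ≤ 1 ∧ |x 2| ≤ 1} := by
  have h1 : Continuous fun x : EuclideanSpace ℝ (Fin 3) => x 0 ^ 2 + x 1 ^ 2 := by fun_prop
  have h2 : Continuous fun x : EuclideanSpace ℝ (Fin 3) => |x 2| := by fun_prop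
  exact closure_minimal (fun x hx => ⟨hx.1.le, hx.2.le⟩)
    ((isClosed_le h1 continuous_const).inter (isClosed_le h2 continuous_const))

lemma isHilbertDomain_cylinder : IsHilbertDomain cylinder where
  nonempty := ⟨0, by simp [cylinder]⟩
  isOpen := isOpen_cylinder
  convex := convex_cylinder
  bounded := by
    refine (Metric.isBounded_closedBall (x := (0 : EuclideanSpace ℝ (Fin 3))) (r := 2)).subset ?_
    intro x hx
    rw [mem_closedBall_zero_iff, EuclideanSpace.norm_eq, Real.sqrt_le_left (by norm_num)]
    have h2 := abs_lt.1 hx.2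
    have h1 := hx.1
    simp only [Fin.sum_univ_three, Real.norm_eq_abs, sq_abs]
    nlinarith

/-- The closure contains vertical segments of the lateral boundary; the midpoint of such a segment
would be interior, but by convexity the interior of the closure is the open cylinder. -/
lemma not_strictConvex_closure_cylinder : ¬ StrictConvex ℝ (closure cylinder) := by
  intro h
  have mem : ∀ z : ℝ, |z| < 1 → !₂[(1 : ℝ), 0, z] ∈ closure cylinder := by
    intro z hz
    have hc : Continuous fun t : ℝ => !₂[t, 0, z] := by
      refine (PiLp.continuous_toLp 2 _).comp (continuous_pi fun i => ?_)
      fin_cases i <;> simp <;> fun_prop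
    have h1 : (1 : ℝ) ∈ closure (Set.Ioo (0 : ℝ) 1) := by
      rw [closure_Ioo (by norm_num)]; simp
    refine map_mem_closure (f := fun t : ℝ => !₂[t, 0, z]) hc h1 fun t ht => ⟨?_, by simpa using hz⟩
    simpa [abs_lt] using ⟨by linarith [ht.1], ht.2⟩
  have hm := h (mem 0 (by norm_num)) (mem (1 / 2) (by norm_num [abs_lt]))
    (fun e => by simpa using congrArg (fun v => v 2) e)
    (a := 1 / 2) (b := 1 / 2) (by norm_num) (by norm_num) (by norm_num)
  rw [convex_cylinder.interior_closure_eq_interior_of_nonempty_interior (by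
    rw [isOpen_cylinder.interior_eq]; exact isHilbertDomain_cylinder.nonempty),
    isOpen_cylinder.interior_eq] at hm
  have := hm.1
  norm_num at this

/-! ### The square slice and the failure of hyperbolicity. -/

/-- Points of the plane `y = 0`, in which the cylinder is a square. -/
def planePoint (a b : ℝ) : EuclideanSpace ℝ (Fin 3) := !₂[a, 0, b]

lemma planePoint_mem_cylinder {a b : ℝ} : planePoint a b ∈ cylinder ↔ |a| < 1 ∧ |b| < 1 := by
  simp [planePoint, cylinder]

lemma planePoint_add_smul_sub (a b c d t : ℝ) :
    planePoint a b + t • (planePoint a b - planePoint c d) =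
      planePoint (a + t * (a - c)) (b + t * (b - d)) := by
  ext i
  fin_cases i <;> simp [planePoint]

lemma hilbertDist_planePoint {a b c d σ τ : ℝ} (hne : a ≠ c ∨ b ≠ d) (hσ : 0 < σ) (hτ : 0 < τ)
    (h1 : ∀ t, 0 ≤ t → (|a + t * (a - c)| < 1 ∧ |b + t * (b - d)| < 1 ↔ t < σ))
    (h2 : ∀ t, 0 ≤ t → (|c + t * (c - a)| < 1 ∧ |d + t * (d - b)| < 1 ↔ t < τ)) :
    hilbertDist cylinder (planePoint a b) (planePoint c d) =
      1 / 2 * Real.log ((1 + σ⁻¹) * (1 + τ⁻¹)) := by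
  refine hilbertDist_eq ?_ hσ hτ (exitTime_eq hσ fun t ht => ?_) (exitTime_eq hτ fun t ht => ?_)
  · intro e
    rcases hne with h | h
    · exact h (by simpa [planePoint] using congrArg (fun v => v 0) e)
    · exact h (by simpa [planePoint] using congrArg (fun v => v 2) e)
  · rw [planePoint_add_smul_sub, planePoint_mem_cylinder, h1 t ht]
  · rw [planePoint_add_smul_sub, planePoint_mem_cylinder, h2 t ht]

/-- Take `w = (0,0)`, `x = (s,0)`, `y = (s,s)`, `z = (0,s)` in the square. The sides and the
diagonal `wy` all have length `(log (1 + s) + k) / 2`, while `xz` has length `k`. So `(x|z)_w` stays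
bounded, whereas `(x|y)_w = (y|z)_w` grows like `k / 4`. -/
lemma not_isGromovHyperbolic_cylinder : ¬ IsGromovHyperbolic cylinder := by
  rintro ⟨δ, hδ, h⟩
  -- The four-point inequality amounts to `k ≤ 4 * δ + log (1 + s)`, and `log (1 + s) ≤ s < 1`.
  set k := 4 * δ + 2 with hk
  set s := 1 - Real.exp (-k) with hs
  have he1 : Real.exp (-k) < 1 := by
    rw [Real.exp_lt_one_iff]; linarith
  have he0 := Real.exp_pos (-k)
  have hs0 : 0 < s := by linarith
  have hs1 : s < 1 := by linarith
  have hσ : 0 < (1 - s) / s := div_pos (by linarith) hs0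
  have hτ : 0 < 1 / s := by positivity
  have hlog1 : Real.log ((1 + ((1 - s) / s)⁻¹) * (1 + (1 / s)⁻¹)) = Real.log (1 + s) + k := by
    have : (1 + ((1 - s) / s)⁻¹) * (1 + (1 / s)⁻¹) = (1 + s) * Real.exp k := by
      have : Real.exp k = (1 - s)⁻¹ := by rw [hs, sub_sub_cancel, Real.exp_neg, inv_inv]
      have h1s : 1 - s ≠ 0 := by linarith
      rw [this]
      field_simp
      ring
    rw [this, Real.log_mul (by linarith) (Real.exp_pos k).ne', Real.log_exp]
  have hlog2 : Real.log ((1 + ((1 - s) / s)⁻¹) * (1 + ((1 - s) / s)⁻¹)) = 2 * k := by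
    have : (1 + ((1 - s) / s)⁻¹) * (1 + ((1 - s) / s)⁻¹) = Real.exp k * Real.exp k := by
      have : Real.exp k = (1 - s)⁻¹ := by rw [hs, sub_sub_cancel, Real.exp_neg, inv_inv]
      have h1s : 1 - s ≠ 0 := by linarith
      rw [this]
      field_simp
      ring
    rw [this, ← Real.exp_add, Real.log_exp]
    ring
  have grow : ∀ t, 0 ≤ t → ∀ b : ℝ, |b| < 1 → (|s + t * s| < 1 ∧ |b| < 1 ↔ t < (1 - s) / s) := by
    intro t ht b hb
    have := mul_nonneg ht hs0.le
    rw [and_iff_left hb, abs_of_nonneg (by positivity), lt_div_iff₀ hs0, lt_sub_iff_add_lt']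
  have shrink : ∀ t, 0 ≤ t → ∀ b : ℝ, |b| < 1 → (|t * -s| < 1 ∧ |b| < 1 ↔ t < 1 / s) := by
    intro t ht b hb
    have := mul_nonneg ht hs0.le
    rw [and_iff_left hb, mul_neg, abs_neg, abs_of_nonneg (by positivity), lt_div_iff₀ hs0]
  -- On the antidiagonal the growing coordinate reaches the side of the square first, since the
  -- other has absolute value smaller by `s`.
  have mix : ∀ t, 0 ≤ t → (|s + t * s| < 1 ∧ |t * -s| < 1 ↔ t < (1 - s) / s) := by
    intro t ht
    have := mul_nonneg ht hs0.le
    rw [mul_neg, abs_neg, abs_of_nonneg (by positivity), abs_of_nonneg this, lt_div_iff₀ hs0]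
    exact ⟨fun h => by linarith, fun h => ⟨by linarith, by linarith⟩⟩
  have hsa : |s| < 1 := by rwa [abs_of_pos hs0]
  have h00 : |(0 : ℝ)| < 1 := by simp
  have dxw : hilbertDist cylinder (planePoint s 0) (planePoint 0 0) =
      1 / 2 * (Real.log (1 + s) + k) := by
    rw [← hlog1]
    refine hilbertDist_planePoint (.inl hs0.ne') hσ hτ (fun t ht => ?_) fun t ht => ?_
    · simpa using grow t ht 0 h00
    · simpa using shrink t ht 0 h00
  have dzw : hilbertDist cylinder (planePoint 0 s) (planePoint 0 0) =
      1 / 2 * (Real.log (1 + s) + k) := by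
    rw [← hlog1]
    refine hilbertDist_planePoint (.inr hs0.ne') hσ hτ (fun t ht => ?_) fun t ht => ?_
    · simpa using grow t ht 0 h00
    · simpa using shrink t ht 0 h00
  have dyw : hilbertDist cylinder (planePoint s s) (planePoint 0 0) =
      1 / 2 * (Real.log (1 + s) + k) := by
    rw [← hlog1]
    refine hilbertDist_planePoint (.inl hs0.ne') hσ hτ (fun t ht => ?_) fun t ht => ?_
    · simpa using grow t ht 0 h00
    · simpa using shrink t ht 0 h00
  have dxy : hilbertDist cylinder (planePoint s 0) (planePoint s s) =
      1 / 2 * (Real.log (1 + s) + k) := by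
    rw [← hlog1, mul_comm (1 + _)]
    refine hilbertDist_planePoint (.inr hs0.ne) hτ hσ (fun t ht => ?_) fun t ht => ?_
    · simpa [hsa] using shrink t ht 0 h00
    · simpa [hsa] using grow t ht 0 h00
  have dyz : hilbertDist cylinder (planePoint s s) (planePoint 0 s) =
      1 / 2 * (Real.log (1 + s) + k) := by
    rw [← hlog1]
    refine hilbertDist_planePoint (.inl hs0.ne') hσ hτ (fun t ht => ?_) fun t ht => ?_
    · simpa [hsa] using grow t ht 0 h00
    · simpa [hsa] using shrink t ht 0 h00
  have dxz : hilbertDist cylinder (planePoint s 0) (planePoint 0 s) = 1 / 2 * (2 * k) := by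
    rw [← hlog2]
    refine hilbertDist_planePoint (.inl hs0.ne') hσ hσ (fun t ht => ?_) fun t ht => ?_
    · simpa using mix t ht
    · simpa [and_comm] using mix t ht
  have hfin := h (planePoint 0 0) (planePoint_mem_cylinder.2 ⟨h00, h00⟩)
    (planePoint s 0) (planePoint_mem_cylinder.2 ⟨hsa, h00⟩)
    (planePoint s s) (planePoint_mem_cylinder.2 ⟨hsa, hsa⟩)
    (planePoint 0 s) (planePoint_mem_cylinder.2 ⟨h00, hsa⟩)
  simp only [gromovProduct, dxw, dzw, dyw, dxy, dyz, dxz, add_sub_cancel_right, min_self] at hfin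
  have hl := Real.log_le_sub_one_of_pos (show 0 < 1 + s by linarith)
  linarith

end Cylinder

/-! ### Comparison of tangent balls and measures with the product geometry. -/

section Coordinates

/-- The defect `1 - x² - y²` from the lateral boundary of the cylinder. -/
def radialGap (p : EuclideanSpace ℝ (Fin 3)) : ℝ := 1 - p 0 ^ 2 - p 1 ^ 2

/-- The defect `1 - y²`: the squared half-length of the chord parallel to the first axis. -/
def chordGap (p : EuclideanSpace ℝ (Fin 3)) : ℝ := 1 - p 1 ^ 2

/-- The defect `1 - z²` from the bottom and the top of the cylinder. -/
def heightGap (p : EuclideanSpace ℝ (Fin 3)) : ℝ := 1 - p 2 ^ 2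

/-- The density of the product of the hyperbolic plane (in the Klein model) and the line. -/
def productWeight (p : EuclideanSpace ℝ (Fin 3)) : ℝ :=
  (radialGap p * √(radialGap p) * heightGap p)⁻¹

lemma radialGap_pos {p : EuclideanSpace ℝ (Fin 3)} (hp : p ∈ cylinder) : 0 < radialGap p := by
  have := hp.1
  unfold radialGap
  linarith

lemma radialGap_le_chordGap (p : EuclideanSpace ℝ (Fin 3)) : radialGap p ≤ chordGap p := by
  unfold radialGap chordGap
  nlinarith [sq_nonneg (p 0)]

lemma chordGap_pos {p : EuclideanSpace ℝ (Fin 3)} (hp : p ∈ cylinder) : 0 < chordGap p :=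
  (radialGap_pos hp).trans_le (radialGap_le_chordGap p)

lemma heightGap_pos {p : EuclideanSpace ℝ (Fin 3)} (hp : p ∈ cylinder) : 0 < heightGap p := by
  have := abs_lt.1 hp.2
  unfold heightGap
  nlinarith

lemma productWeight_pos {p : EuclideanSpace ℝ (Fin 3)} (hp : p ∈ cylinder) :
    0 < productWeight p := by
  have := radialGap_pos hp
  have := heightGap_pos hp
  unfold productWeight
  positivity

@[fun_prop]
lemma continuous_radialGap : Continuous radialGap := by unfold radialGap; fun_prop

@[fun_prop]
lemma continuous_chordGap : Continuous chordGap := by unfold chordGap; fun_prop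

@[fun_prop]
lemma continuous_heightGap : Continuous heightGap := by unfold heightGap; fun_prop

lemma measurable_productWeight : Measurable productWeight := by
  have h1 := continuous_radialGap.measurable
  have h2 := continuous_heightGap.measurable
  unfold productWeight
  fun_prop

lemma continuousOn_productWeight : ContinuousOn productWeight cylinder := by
  unfold productWeight
  refine ContinuousOn.inv₀ (by fun_prop) fun p hp => ?_
  have := radialGap_pos hp
  have := heightGap_pos hp
  positivity

/-- The quadratic form such that the Klein norm of `u` at `p` is `√(Q u) / (1 - x² - y²)`. -/
def kleinForm (p u : EuclideanSpace ℝ (Fin 3)) : ℝ :=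
  (p 0 * u 0 + p 1 * u 1) ^ 2 + radialGap p * (u 0 ^ 2 + u 1 ^ 2)

/-- Completing the square in `u 0`; the two squares become the first two rows of
`normalizingMatrix`. -/
lemma chordGap_mul_kleinForm (p u : EuclideanSpace ℝ (Fin 3)) :
    chordGap p * kleinForm p u =
      (chordGap p * u 0 + p 0 * p 1 * u 1) ^ 2 + radialGap p * u 1 ^ 2 := by
  unfold chordGap kleinForm radialGap
  ring

/-- The Hilbert norm of the disk is bounded by that of the cylinder. A time `r` spent in the closed
disk satisfies a quadratic inequality, which solved for `r⁻¹` reads `√Q ≤ m * r⁻¹ - c`; adding the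
forward and backward versions cancels `c`. -/
lemma kleinForm_le {p u : EuclideanSpace ℝ (Fin 3)} (hp : p ∈ cylinder) {s t : ℝ} (hs : 0 < s)
    (ht : 0 < t) (h1 : p + s • u ∈ closure cylinder) (h2 : p - t • u ∈ closure cylinder) :
    kleinForm p u ≤ (radialGap p * (1 / 2 * (s⁻¹ + t⁻¹))) ^ 2 := by
  have hm := radialGap_pos hp
  have h1 := (closure_cylinder_subset h1).1
  have h2 := (closure_cylinder_subset h2).1
  simp only [PiLp.add_apply, PiLp.sub_apply, PiLp.smul_apply, smul_eq_mul] at h1 h2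
  set c := p 0 * u 0 + p 1 * u 1 with hc
  set v := u 0 ^ 2 + u 1 ^ 2 with hv
  set m := radialGap p with hmd
  have hv0 : 0 ≤ v := by positivity
  have e1 : s ^ 2 * v + 2 * s * c ≤ m := by
    rw [hv, hc, hmd, radialGap]; linarith
  have e2 : t ^ 2 * v - 2 * t * c ≤ m := by
    rw [hv, hc, hmd, radialGap]; linarith
  have key : ∀ {c r : ℝ}, 0 < r → r ^ 2 * v + 2 * r * c ≤ m →
      √(c ^ 2 + m * v) ≤ m * r⁻¹ - c := by
    intro c r hr h
    have hQ : c ^ 2 ≤ c ^ 2 + m * v := by nlinarith [mul_nonneg hm.le hv0]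
    have hcs : c ≤ √(c ^ 2 + m * v) := Real.le_sqrt_of_sq_le hQ
    have hsq : c ^ 2 + m * v ≤ (m * r⁻¹ - c) ^ 2 := by
      have : v + 2 * r⁻¹ * c ≤ m * r⁻¹ ^ 2 := by
        have := mul_le_mul_of_nonneg_left h (show 0 ≤ r⁻¹ ^ 2 by positivity)
        calc v + 2 * r⁻¹ * c = r⁻¹ ^ 2 * (r ^ 2 * v + 2 * r * c) := by field_simp
          _ ≤ _ := by linarith
      nlinarith [mul_le_mul_of_nonneg_left this hm.le]
    rcases le_or_gt 0 (m * r⁻¹ - c) with h0 | h0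
    · exact Real.sqrt_le_iff.2 ⟨h0, hsq⟩
    · exfalso
      have h3 : 0 < m * r⁻¹ := by positivity
      nlinarith [mul_nonneg hm.le hv0]
  have k1 := key hs e1
  have k2 := key (c := -c) ht (by linarith)
  rw [neg_sq] at k2
  have hQ : kleinForm p u = √(c ^ 2 + m * v) ^ 2 := by
    rw [Real.sq_sqrt (by positivity), kleinForm]
  rw [hQ]
  refine pow_le_pow_left₀ (Real.sqrt_nonneg _) ?_ 2
  linarith

/-- The same comparison for the interval. The bounds at the two ends are combined with weights `1 +
z` and `1 - z`, so that both right-hand sides contain `1 - z²`. -/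
lemma abs_height_le {p u : EuclideanSpace ℝ (Fin 3)} (hp : p ∈ cylinder) {s t : ℝ} (hs : 0 < s)
    (ht : 0 < t) (h1 : p + s • u ∈ closure cylinder) (h2 : p - t • u ∈ closure cylinder) :
    |u 2| ≤ heightGap p * (1 / 2 * (s⁻¹ + t⁻¹)) := by
  have h1 := abs_le.1 (closure_cylinder_subset h1).2
  have h2 := abs_le.1 (closure_cylinder_subset h2).2
  simp only [PiLp.add_apply, PiLp.sub_apply, PiLp.smul_apply, smul_eq_mul] at h1 h2
  have hz := abs_lt.1 hp.2
  unfold heightGap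
  have aux : ∀ {r b : ℝ}, 0 < r → r * u 2 ≤ b → u 2 ≤ r⁻¹ * b := by
    intro r b hr h
    rw [inv_mul_eq_div, le_div_iff₀ hr]; linarith
  have aux' : ∀ {r b : ℝ}, 0 < r → -b ≤ r * u 2 → -(u 2) ≤ r⁻¹ * b := by
    intro r b hr h
    rw [inv_mul_eq_div, le_div_iff₀ hr]; linarith
  have a1 := aux hs (b := 1 - p 2) (by linarith)
  have a2 := aux ht (b := 1 + p 2) (by linarith)
  have a3 := aux' hs (b := 1 + p 2) (by linarith)
  have a4 := aux' ht (b := 1 - p 2) (by linarith)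
  refine abs_le'.2 ⟨?_, ?_⟩
  · nlinarith [mul_le_mul_of_nonneg_left a1 (show 0 ≤ 1 + p 2 by linarith),
      mul_le_mul_of_nonneg_left a2 (show 0 ≤ 1 - p 2 by linarith)]
  · nlinarith [mul_le_mul_of_nonneg_left a3 (show 0 ≤ 1 - p 2 by linarith),
      mul_le_mul_of_nonneg_left a4 (show 0 ≤ 1 + p 2 by linarith)]

/-- The matrix of coordinates of `ℝ³` in which the tangent ball at `p` is comparable with a
cube. -/
def normalizingMatrix (p : EuclideanSpace ℝ (Fin 3)) : Matrix (Fin 3) (Fin 3) ℝ :=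
  !![√(chordGap p) / radialGap p, p 0 * p 1 / (√(chordGap p) * radialGap p), 0;
     0, (√(radialGap p) * √(chordGap p))⁻¹, 0;
     0, 0, (heightGap p)⁻¹]

/-- The parallelepiped that is a cube of half-side `r` in normalizing coordinates. -/
def normalizedCube (p : EuclideanSpace ℝ (Fin 3)) (r : ℝ) : Set (EuclideanSpace ℝ (Fin 3)) :=
  {u | ∀ i, |(normalizingMatrix p).mulVec u.ofLp i| ≤ r}

lemma det_normalizingMatrix {p : EuclideanSpace ℝ (Fin 3)} (hp : p ∈ cylinder) :
    (normalizingMatrix p).det = productWeight p := by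
  have := radialGap_pos hp
  have := chordGap_pos hp
  have := heightGap_pos hp
  rw [normalizingMatrix, Matrix.det_fin_three, productWeight]
  simp
  field_simp

lemma volume_normalizedCube {p : EuclideanSpace ℝ (Fin 3)} (hp : p ∈ cylinder) {r : ℝ}
    (hr : 0 ≤ r) : volume (normalizedCube p r) = ENNReal.ofReal (8 * r ^ 3 / productWeight p) := by
  have hw := productWeight_pos hp
  have hdet : LinearMap.det (Matrix.toLin' (normalizingMatrix p)) = productWeight p := by
    rw [LinearMap.det_toLin', det_normalizingMatrix hp]
  have e : normalizedCube p r = (WithLp.ofLp : EuclideanSpace ℝ (Fin 3) → Fin 3 → ℝ) ⁻¹'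
      (Matrix.toLin' (normalizingMatrix p) ⁻¹' Set.Icc (fun _ => -r) (fun _ => r)) := by
    ext u
    simp [normalizedCube, Set.mem_Icc, Pi.le_def, abs_le, forall_and]
  have hms : MeasurableSet (Matrix.toLin' (normalizingMatrix p) ⁻¹'
      Set.Icc (fun _ => -r) (fun _ => r)) :=
    (LinearMap.continuous_of_finiteDimensional _).measurable measurableSet_Icc
  rw [e, (PiLp.volume_preserving_ofLp (Fin 3)).measure_preimage hms.nullMeasurableSet,
    Measure.addHaar_preimage_linearMap _ (by rw [hdet]; exact hw.ne'), hdet, Real.volume_Icc_pi,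
    abs_of_pos (inv_pos.2 hw), Finset.prod_const, Finset.card_univ, Fintype.card_fin,
    ← ENNReal.ofReal_pow (by linarith), ← ENNReal.ofReal_mul (by positivity)]
  congr 1
  field_simp
  ring

lemma mem_normalizedCube_iff {p u : EuclideanSpace ℝ (Fin 3)} (hp : p ∈ cylinder) {r : ℝ} :
    u ∈ normalizedCube p r ↔
      |chordGap p * u 0 + p 0 * p 1 * u 1| ≤ r * (√(chordGap p) * radialGap p) ∧
      |u 1| ≤ r * (√(radialGap p) * √(chordGap p)) ∧ |u 2| ≤ r * heightGap p := by
  have hm := radialGap_pos hp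
  have hc := chordGap_pos hp
  have hh := heightGap_pos hp
  have e0 : (normalizingMatrix p).mulVec u.ofLp 0 =
      (chordGap p * u 0 + p 0 * p 1 * u 1) / (√(chordGap p) * radialGap p) := by
    simp [normalizingMatrix, Matrix.mulVec, dotProduct, Fin.sum_univ_three]
    field_simp
    rw [Real.sq_sqrt hc.le]
    ring
  have e1 : (normalizingMatrix p).mulVec u.ofLp 1 = u 1 / (√(radialGap p) * √(chordGap p)) := by
    simp [normalizingMatrix, Matrix.mulVec, dotProduct, Fin.sum_univ_three]
    field_simp
  have e2 : (normalizingMatrix p).mulVec u.ofLp 2 = u 2 / heightGap p := by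
    simp [normalizingMatrix, Matrix.mulVec, dotProduct, Fin.sum_univ_three]
    field_simp
  have hd : ∀ {a b : ℝ}, 0 < b → (|a / b| ≤ r ↔ |a| ≤ r * b) := by
    intro a b hb
    rw [abs_div, abs_of_pos hb, div_le_iff₀ hb]
  rw [← hd (by positivity), ← hd (by positivity), ← hd hh, ← e0, ← e1, ← e2]
  simp [normalizedCube, Fin.forall_fin_succ]

lemma tangentBall_subset_normalizedCube {p : EuclideanSpace ℝ (Fin 3)} (hp : p ∈ cylinder) :
    tangentBall cylinder p ⊆ normalizedCube p 1 := by
  intro u hu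
  have hm := radialGap_pos hp
  have hc := chordGap_pos hp
  have hh := heightGap_pos hp
  rcases eq_or_ne u 0 with rfl | hu0
  · rw [mem_normalizedCube_iff hp]
    simp
    exact ⟨by positivity, by positivity, hh.le⟩
  have hC := isHilbertDomain_cylinder
  have t1 := exitTime_pos hC hp hu0
  have t2 := exitTime_pos hC hp (neg_ne_zero.2 hu0)
  have c1 := exitPoint_mem_closure hC hp hu0
  have c2 := exitPoint_mem_closure hC hp (neg_ne_zero.2 hu0)
  rw [smul_neg, ← sub_eq_add_neg] at c2
  have hQ := kleinForm_le hp t1 t2 c1 c2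
  have hH := abs_height_le hp t1 t2 c1 c2
  rw [← finslerNorm_eq hC hp hu0] at hQ hH
  have hF0 := finslerNorm_pos hC hp hu0
  have hF1 : finslerNorm cylinder p u < 1 := hu
  have hQ1 : kleinForm p u ≤ radialGap p ^ 2 := by
    refine hQ.trans (pow_le_pow_left₀ (by positivity) ?_ 2)
    nlinarith
  have hQ2 := mul_le_mul_of_nonneg_left hQ1 hc.le
  rw [chordGap_mul_kleinForm] at hQ2
  rw [mem_normalizedCube_iff hp]
  refine ⟨abs_le_of_sq_le_sq ?_ (by positivity), abs_le_of_sq_le_sq ?_ (by positivity), ?_⟩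
  · rw [one_mul, mul_pow, Real.sq_sqrt hc.le]
    nlinarith [mul_nonneg hm.le (sq_nonneg (u 1))]
  · rw [one_mul, mul_pow, Real.sq_sqrt hc.le, Real.sq_sqrt hm.le]
    nlinarith [sq_nonneg (chordGap p * u 0 + p 0 * p 1 * u 1)]
  · nlinarith

lemma finslerNorm_le_half {p u : EuclideanSpace ℝ (Fin 3)} (hp : p ∈ cylinder)
    (hu : u ∈ normalizedCube p (1 / 8)) : finslerNorm cylinder p u ≤ 1 / 2 := by
  have hm := radialGap_pos hp
  have hc := chordGap_pos hp
  rw [mem_normalizedCube_iff hp] at hu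
  obtain ⟨h1, h2, h3⟩ := hu
  have s1 := sq_le_sq' (abs_le.1 h1).1 (abs_le.1 h1).2
  have s2 := sq_le_sq' (abs_le.1 h2).1 (abs_le.1 h2).2
  rw [mul_pow, mul_pow, Real.sq_sqrt hc.le] at s1
  rw [mul_pow, mul_pow, Real.sq_sqrt hc.le, Real.sq_sqrt hm.le] at s2
  -- Each of the two squares contributes `1/64`. This leaves `4 * |c| + 4 * v ≤ (4/5 + 1/8) *
  -- radialGap p`, so `p ± 2 • u` stays in the cylinder.
  have hQ : kleinForm p u ≤ radialGap p ^ 2 / 32 := by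
    refine le_of_mul_le_mul_left ?_ hc
    rw [chordGap_mul_kleinForm]
    nlinarith [mul_le_mul_of_nonneg_left s2 hm.le]
  set c := p 0 * u 0 + p 1 * u 1 with hcd
  set v := u 0 ^ 2 + u 1 ^ 2 with hv
  have hv0 : 0 ≤ v := by positivity
  have hQ' : c ^ 2 + radialGap p * v ≤ radialGap p ^ 2 / 32 := hQ
  have hc' : |c| ≤ radialGap p / 5 :=
    abs_le_of_sq_le_sq (by nlinarith [mul_nonneg hm.le hv0]) (by positivity)
  have hc' := abs_le.1 hc'
  have hv' : v ≤ radialGap p / 32 := by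
    refine le_of_mul_le_mul_left ?_ hm
    nlinarith [sq_nonneg c]
  have hz := abs_lt.1 hp.2
  have h3 := abs_le.1 h3
  unfold heightGap at h3
  rw [show (1 / 2 : ℝ) = 2⁻¹ by norm_num]
  refine finslerNorm_le_inv isHilbertDomain_cylinder hp (by norm_num) ⟨?_, ?_⟩ ⟨?_, ?_⟩
  · have : (p 0 + 2 * u 0) ^ 2 + (p 1 + 2 * u 1) ^ 2 = 1 - radialGap p + 4 * c + 4 * v := by
      rw [radialGap, hcd, hv]; ring
    simp only [PiLp.add_apply, PiLp.smul_apply, smul_eq_mul]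
    linarith
  · simp only [PiLp.add_apply, PiLp.smul_apply, smul_eq_mul]
    rw [abs_lt]
    constructor <;> nlinarith
  · have : (p 0 - 2 * u 0) ^ 2 + (p 1 - 2 * u 1) ^ 2 = 1 - radialGap p - 4 * c + 4 * v := by
      rw [radialGap, hcd, hv]; ring
    simp only [PiLp.sub_apply, PiLp.smul_apply, smul_eq_mul]
    linarith
  · simp only [PiLp.sub_apply, PiLp.smul_apply, smul_eq_mul]
    rw [abs_lt]
    constructor <;> nlinarith

lemma finslerNorm_single_le {p : EuclideanSpace ℝ (Fin 3)} (hp : p ∈ cylinder) :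
    finslerNorm cylinder p (EuclideanSpace.single 0 1) ≤ 4 * √(chordGap p) / radialGap p := by
  have hm := radialGap_pos hp
  have hc := chordGap_pos hp
  have hh := heightGap_pos hp
  -- The largest multiple of the first basis vector that fits in the cube of half-side 1/8.
  set a := radialGap p / (8 * √(chordGap p)) with ha
  have ha0 : 0 < a := by positivity
  have hmem : a • EuclideanSpace.single (0 : Fin 3) (1 : ℝ) ∈ normalizedCube p (1 / 8) := by
    rw [mem_normalizedCube_iff hp]
    simp
    refine ⟨?_, by positivity, by positivity⟩
    rw [abs_of_pos hc, abs_of_pos ha0, ha]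
    apply le_of_eq
    field_simp
    rw [Real.sq_sqrt hc.le]
  have := finslerNorm_le_half hp hmem
  rw [finslerNorm_smul isHilbertDomain_cylinder hp ha0, ← le_div_iff₀' ha0] at this
  refine this.trans (le_of_eq ?_)
  rw [ha]
  field_simp
  norm_num

/-- The reference measure, with the density of the product of the hyperbolic plane and the
line. -/
def productMeasure : Measure (EuclideanSpace ℝ (Fin 3)) :=
  (volume.restrict cylinder).withDensity fun p => ENNReal.ofReal (productWeight p)

lemma unitBallVolume_ne_zero (n : ℕ) : unitBallVolume n ≠ 0 :=
  (Metric.measure_ball_pos _ _ one_pos).ne'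

lemma unitBallVolume_ne_top (n : ℕ) : unitBallVolume n ≠ ∞ := measure_ball_lt_top.ne

/-- The tangent ball contains the cube of half-side 1/8, of volume `1 / (64 * productWeight p)`. -/
lemma hilbertMeasure_cylinder_le :
    hilbertMeasure cylinder ≤ (unitBallVolume 3 * 64) • productMeasure := by
  rw [productMeasure, ← withDensity_smul _ measurable_productWeight.ennreal_ofReal]
  refine withDensity_mono ((ae_restrict_iff' isOpen_cylinder.measurableSet).2 (.of_forall ?_))
  intro p hp
  have hw := productWeight_pos hp
  have h1 : ENNReal.ofReal (8 * (1 / 8) ^ 3 / productWeight p) ≤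
      volume (tangentBall cylinder p) := by
    rw [← volume_normalizedCube hp (by norm_num)]
    refine measure_mono fun u hu => ?_
    exact lt_of_le_of_lt (finslerNorm_le_half hp hu) (by norm_num)
  rw [Pi.smul_apply, smul_eq_mul, mul_assoc]
  simp only [div_eq_mul_inv (unitBallVolume 3)]
  gcongr
  refine (ENNReal.inv_le_inv.2 h1).trans (le_of_eq ?_)
  rw [← ENNReal.ofReal_inv_of_pos (by positivity),
    show (64 : ℝ≥0∞) = ENNReal.ofReal 64 by simp, ← ENNReal.ofReal_mul (by norm_num)]
  congr 1
  field_simp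
  norm_num

lemma le_hilbertMeasure_cylinder :
    (unitBallVolume 3 / 8) • productMeasure ≤ hilbertMeasure cylinder := by
  rw [productMeasure, ← withDensity_smul _ measurable_productWeight.ennreal_ofReal]
  refine withDensity_mono ((ae_restrict_iff' isOpen_cylinder.measurableSet).2 (.of_forall ?_))
  intro p hp
  have hw := productWeight_pos hp
  have h1 : volume (tangentBall cylinder p) ≤ ENNReal.ofReal (8 * 1 ^ 3 / productWeight p) := by
    rw [← volume_normalizedCube hp (by norm_num)]
    exact measure_mono (tangentBall_subset_normalizedCube hp)
  simp only [Pi.smul_apply, smul_eq_mul, div_eq_mul_inv (unitBallVolume 3), mul_assoc]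
  gcongr
  refine le_trans (le_of_eq ?_) (ENNReal.inv_le_inv.2 h1)
  rw [← ENNReal.ofReal_inv_of_pos (by positivity),
    show (8 : ℝ≥0∞) = ENNReal.ofReal 8 by simp, ← ENNReal.ofReal_inv_of_pos (by norm_num),
    ← ENNReal.ofReal_mul (by norm_num)]
  congr 1
  field_simp

end Coordinates

/-! ### The primitive of the product density along the first axis. -/

section Flux

/-- A primitive of `productWeight` along the first axis. -/
def flux (p : EuclideanSpace ℝ (Fin 3)) : ℝ :=
  p 0 / (chordGap p * √(radialGap p) * heightGap p)

/-- The natural bound for `flux`. -/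
def fluxBound (p : EuclideanSpace ℝ (Fin 3)) : ℝ :=
  (√(chordGap p) * √(radialGap p) * heightGap p)⁻¹

lemma fluxBound_pos {p : EuclideanSpace ℝ (Fin 3)} (hp : p ∈ cylinder) : 0 < fluxBound p := by
  have := radialGap_pos hp
  have := chordGap_pos hp
  have := heightGap_pos hp
  unfold fluxBound
  positivity

lemma abs_flux_le {p : EuclideanSpace ℝ (Fin 3)} (hp : p ∈ cylinder) :
    |flux p| ≤ fluxBound p := by
  have hm := radialGap_pos hp
  have hc := chordGap_pos hp
  have hh := heightGap_pos hp
  have h0 : |p 0| ≤ √(chordGap p) := by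
    refine Real.le_sqrt_of_sq_le ?_
    rw [sq_abs]
    unfold radialGap at hm
    unfold chordGap
    linarith
  rw [flux, fluxBound, abs_div, abs_of_pos (a := chordGap p * _ * _) (by positivity),
    div_le_iff₀ (by positivity)]
  refine h0.trans (le_of_eq ?_)
  field_simp
  rw [Real.sq_sqrt hc.le]

/-- With `C = chordGap p` constant along the line, this is the derivative `C / (C - x²)^(3/2)` of `x
/ √(C - x²)`. -/
lemma hasLineDerivAt_flux {p : EuclideanSpace ℝ (Fin 3)} (hp : p ∈ cylinder) :
    HasLineDerivAt ℝ flux (productWeight p) p (EuclideanSpace.single 0 1) := by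
  have hm := radialGap_pos hp
  have hc := chordGap_pos hp
  have hh := heightGap_pos hp
  have e : (fun t : ℝ => flux (p + t • EuclideanSpace.single 0 1)) = fun t : ℝ =>
      (p 0 + t) / (chordGap p * √(1 - (p 0 + t) ^ 2 - p 1 ^ 2) * heightGap p) := by
    ext t
    simp [flux, chordGap, radialGap, heightGap]
  unfold HasLineDerivAt
  rw [e]
  have h1 : HasDerivAt (fun t : ℝ => p 0 + t) 1 0 := (hasDerivAt_id 0).const_add _
  have h2 : HasDerivAt (fun t : ℝ => 1 - (p 0 + t) ^ 2 - p 1 ^ 2) (-(2 * p 0)) 0 := by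
    refine (((h1.pow 2).const_sub 1).sub_const (p 1 ^ 2)).congr_deriv ?_
    simp
  have hr : 1 - (p 0 + 0) ^ 2 - p 1 ^ 2 = radialGap p := by simp [radialGap]
  have h3 := h2.sqrt (by rw [hr]; exact hm.ne')
  have h4 := h1.div ((h3.const_mul (chordGap p)).mul_const (heightGap p))
    (by rw [hr]; positivity)
  rw [hr] at h4
  refine h4.congr_deriv ?_
  have hs := Real.sq_sqrt hm.le
  have hcm : chordGap p = radialGap p + p 0 ^ 2 := by unfold chordGap radialGap; ring
  rw [productWeight, add_zero]
  have hspos : 0 < √(radialGap p) := Real.sqrt_pos.2 hm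
  -- Naming the root and writing `radialGap p = s ^ 2` turns the goal into an identity of rational
  -- functions.
  generalize √(radialGap p) = s at *
  rw [← hs] at hcm ⊢
  rw [hcm]
  have : 0 < s ^ 2 + p 0 ^ 2 := by positivity
  field_simp
  ring

lemma contDiffAt_flux {p : EuclideanSpace ℝ (Fin 3)} (hp : p ∈ cylinder) :
    ContDiffAt ℝ 1 flux p := by
  have hm := radialGap_pos hp
  have hc := chordGap_pos hp
  have hh := heightGap_pos hp
  have d : ∀ i, ContDiffAt ℝ 1 (fun q : EuclideanSpace ℝ (Fin 3) => q i) p := by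
    intro i
    fun_prop
  unfold flux
  refine (d 0).div (((?_ : ContDiffAt ℝ 1 chordGap p).mul
    (ContDiffAt.sqrt (?_ : ContDiffAt ℝ 1 radialGap p) hm.ne')).mul
      (?_ : ContDiffAt ℝ 1 heightGap p)) (by positivity)
  · unfold chordGap; fun_prop
  · unfold radialGap; fun_prop
  · unfold heightGap; fun_prop

end Flux

/-! ### The Hardy inequality and the bottom of the spectrum. -/

section Spectrum

/-- A compactly supported Lipschitz function that agrees with `flux` on a compact subset of the
cylinder. -/
lemma exists_lipschitz_cutoff_flux {K : Set (EuclideanSpace ℝ (Fin 3))} (hK : IsCompact K)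
    (hKC : K ⊆ cylinder) : ∃ (G : EuclideanSpace ℝ (Fin 3) → ℝ) (D : ℝ≥0), LipschitzWith D G ∧
      HasCompactSupport G ∧ ∀ p ∈ K, G =ᶠ[nhds p] flux := by
  obtain ⟨L, hL, hKL, hLC⟩ := exists_compact_between hK isOpen_cylinder hKC
  obtain ⟨χ, h1, h0, -⟩ := exists_contMDiffMap_one_nhds_of_subset_interior (n := 1)
    (modelWithCornersSelf ℝ (EuclideanSpace ℝ (Fin 3))) hK.isClosed hKL
  have hsub : tsupport χ ⊆ L := closure_minimal
    (fun x hx => by by_contra h; exact hx (h0 x h)) hL.isClosed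
  have hcs : HasCompactSupport fun x => χ x * flux x :=
    HasCompactSupport.mul_right (f := χ) (hL.of_isClosed_subset isClosed_closure hsub)
  have hcd : ContDiff ℝ 1 fun x => χ x * flux x := by
    refine contDiff_iff_contDiffAt.2 fun x => ?_
    by_cases hx : x ∈ tsupport χ
    · exact χ.contMDiff.contDiff.contDiffAt.mul (contDiffAt_flux (hLC (hsub hx)))
    · have h := notMem_tsupport_iff_eventuallyEq.1 hx
      refine (contDiffAt_const (c := (0 : ℝ))).congr_of_eventuallyEq ?_
      filter_upwards [h] with y hy
      simp [hy]
  obtain ⟨D, hD⟩ := ContDiff.lipschitzWith_of_hasCompactSupport hcs hcd one_ne_zero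
  refine ⟨_, D, hD, hcs, fun p hp => ?_⟩
  filter_upwards [Filter.Eventually.filter_mono (nhds_le_nhdsSet hp) h1] with y hy
  rw [hy, one_mul]

/-- Integration by parts with `productWeight = ∂₀ flux`. Since `flux` is only regular inside the
cylinder, it is replaced by a Lipschitz cutoff equal to it near the support of `f`. -/
lemma integral_sq_mul_productWeight_eq {f : EuclideanSpace ℝ (Fin 3) → ℝ}
    (hf : IsTestFunction cylinder f) :
    ∫ p, f p ^ 2 * productWeight p =
      - ∫ p, 2 * f p * lineDeriv ℝ f p (EuclideanSpace.single 0 1) * flux p := by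
  obtain ⟨K, hK⟩ := hf.lipschitz
  obtain ⟨G, D, hG, hGc, hGf⟩ := exists_lipschitz_cutoff_flux hf.compactSupport hf.support_subset
  obtain ⟨M, hM⟩ := hf.compactSupport.exists_bound_of_continuous hK.continuous
  have hM0 : 0 ≤ M := (norm_nonneg _).trans (hM 0)
  have hf2 : LipschitzWith (K * (2 * M.toNNReal)) fun p => f p ^ 2 := by
    refine LipschitzWith.of_dist_le_mul fun x y => ?_
    have h1 := hK.dist_le_mul x y
    rw [Real.dist_eq] at h1 ⊢
    have h2 : |f x + f y| ≤ 2 * M := by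
      have := abs_add_le (f x) (f y)
      have := hM x
      have := hM y
      rw [Real.norm_eq_abs] at *
      linarith
    calc |f x ^ 2 - f y ^ 2| = |f x - f y| * |f x + f y| := by rw [← abs_mul]; ring_nf
      _ ≤ (K * dist x y) * (2 * M) := by gcongr
      _ = _ := by push_cast; rw [Real.coe_toNNReal _ hM0]; ring
  have hibp := hf2.integral_lineDeriv_mul_eq (μ := volume) hG hGc (EuclideanSpace.single 0 1)
  have e1 : ∫ p, f p ^ 2 * productWeight p =
      - ∫ p, lineDeriv ℝ G p (-(EuclideanSpace.single 0 1)) * f p ^ 2 := by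
    rw [← integral_neg]
    congr 1
    ext p
    rcases eq_or_ne (f p) 0 with h | h
    · simp [h]
    have hp := subset_tsupport f h
    rw [lineDeriv_neg, (hGf p hp).lineDeriv_eq,
      (hasLineDerivAt_flux (hf.support_subset hp)).lineDeriv]
    ring
  rw [e1, ← hibp]
  congr 1
  refine integral_congr_ae ?_
  filter_upwards [hK.ae_differentiableAt (μ := volume)] with p hp
  have h2 : lineDeriv ℝ (fun p => f p ^ 2) p (EuclideanSpace.single 0 1) =
      2 * f p * lineDeriv ℝ f p (EuclideanSpace.single 0 1) := by
    have h := hp.hasFDerivAt.pow 2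
    rw [h.differentiableAt.lineDeriv_eq_fderiv, hp.lineDeriv_eq_fderiv, h.fderiv]
    simp
  rw [h2]
  rcases eq_or_ne (f p) 0 with h | h
  · simp [h]
  rw [(hGf p (subset_tsupport f h)).eq_of_nhds]

lemma continuous_sq_mul_productWeight {f : EuclideanSpace ℝ (Fin 3) → ℝ}
    (hf : IsTestFunction cylinder f) : Continuous fun p => f p ^ 2 * productWeight p := by
  obtain ⟨K, hK⟩ := hf.lipschitz
  refine ContinuousOn.continuous_of_tsupport_subset (s := cylinder)
    ((hK.continuous.pow 2).continuousOn.mul continuousOn_productWeight) isOpen_cylinder ?_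
  refine (closure_mono fun p hp => ?_).trans hf.support_subset
  intro h
  simp [h] at hp

lemma hasCompactSupport_sq_mul_productWeight {f : EuclideanSpace ℝ (Fin 3) → ℝ}
    (hf : IsTestFunction cylinder f) :
    HasCompactSupport fun p => f p ^ 2 * productWeight p :=
  hf.compactSupport.mono fun p hp h => by simp [h] at hp

lemma sq_mul_productWeight_nonneg {f : EuclideanSpace ℝ (Fin 3) → ℝ}
    (hf : IsTestFunction cylinder f) (p : EuclideanSpace ℝ (Fin 3)) :
    0 ≤ f p ^ 2 * productWeight p := by
  rcases eq_or_ne (f p) 0 with h | h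
  · simp [h]
  have := productWeight_pos (hf.support_subset (subset_tsupport f h))
  positivity

/-- The energy density of `f` in the direction of the first axis. -/
def axialEnergy (f : EuclideanSpace ℝ (Fin 3) → ℝ) (p : EuclideanSpace ℝ (Fin 3)) : ℝ :=
  lineDeriv ℝ f p (EuclideanSpace.single 0 1) ^ 2 * (radialGap p ^ 2 / chordGap p)

lemma measurable_axialEnergy {f : EuclideanSpace ℝ (Fin 3) → ℝ} (hf : Continuous f) :
    Measurable (axialEnergy f) := by
  have h1 := measurable_lineDeriv (𝕜 := ℝ) (v := EuclideanSpace.single (0 : Fin 3) (1 : ℝ)) hf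
  have h2 := continuous_radialGap.measurable
  have h3 := continuous_chordGap.measurable
  unfold axialEnergy
  fun_prop

/-- The weighted arithmetic-geometric inequality; the coefficient `1/2` is chosen so that the first
term can be absorbed. -/
lemma abs_two_mul_flux_le (f : EuclideanSpace ℝ (Fin 3) → ℝ) {p : EuclideanSpace ℝ (Fin 3)}
    (hp : p ∈ cylinder) :
    |2 * f p * lineDeriv ℝ f p (EuclideanSpace.single 0 1) * flux p| ≤
      1 / 2 * (f p ^ 2 * productWeight p) + 2 * (axialEnergy f p * productWeight p) := by
  have hm := radialGap_pos hp
  have hc := chordGap_pos hp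
  have hh := heightGap_pos hp
  have hw := productWeight_pos hp
  have hΦ := abs_flux_le hp
  set D := lineDeriv ℝ f p (EuclideanSpace.single 0 1) with hD
  set a := radialGap p / √(chordGap p) with ha
  have ha0 : 0 < a := by positivity
  have hb : fluxBound p = productWeight p * a := by
    rw [fluxBound, productWeight, ha]
    field_simp
  have hE : axialEnergy f p = D ^ 2 * a ^ 2 := by
    rw [axialEnergy, ha, div_pow, Real.sq_sqrt hc.le]
  rw [hE]
  calc |2 * f p * D * flux p| = 2 * |f p| * |D| * |flux p| := by simp [abs_mul]
    _ ≤ 2 * |f p| * |D| * (productWeight p * a) := by rw [← hb]; gcongr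
    _ ≤ _ := by
      rw [← sq_abs (f p), ← sq_abs D]
      nlinarith [mul_nonneg hw.le (sq_nonneg (|f p| - 2 * |D| * a))]

/-- A Hardy inequality, from the divergence of the vector field `flux` along the first axis. -/
lemma lintegral_sq_le {f : EuclideanSpace ℝ (Fin 3) → ℝ} (hf : IsTestFunction cylinder f) :
    ∫⁻ p, ENNReal.ofReal (f p ^ 2 * productWeight p) ≤
      4 * ∫⁻ p, ENNReal.ofReal (cylinder.indicator (fun p => axialEnergy f p * productWeight p) p)
      := by
  obtain ⟨K, hK⟩ := hf.lipschitz
  set B := cylinder.indicator (fun p => axialEnergy f p * productWeight p) with hB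
  have hB0 : ∀ p, 0 ≤ B p := by
    refine Set.indicator_nonneg fun p hp => ?_
    have := productWeight_pos hp
    have := chordGap_pos hp
    unfold axialEnergy
    positivity
  have hBm : Measurable B :=
    ((measurable_axialEnergy hK.continuous).mul measurable_productWeight).indicator
      isOpen_cylinder.measurableSet
  -- Infinite energy is trivial; otherwise both sides become finite Bochner integrals, as absorption
  -- requires.
  rcases eq_or_ne (∫⁻ p, ENNReal.ofReal (B p)) ∞ with h | h
  · rw [h]; simp
  have hBi : Integrable B :=
    (lintegral_ofReal_ne_top_iff_integrable hBm.aestronglyMeasurable (.of_forall hB0)).1 h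
  have hAi := (continuous_sq_mul_productWeight hf).integrable_of_hasCompactSupport
    (hasCompactSupport_sq_mul_productWeight hf) (μ := volume)
  rw [← ofReal_integral_eq_lintegral_ofReal hBi (.of_forall hB0),
    ← ofReal_integral_eq_lintegral_ofReal hAi (.of_forall (sq_mul_productWeight_nonneg hf)),
    show (4 : ℝ≥0∞) = ENNReal.ofReal 4 by simp, ← ENNReal.ofReal_mul (by norm_num)]
  refine ENNReal.ofReal_le_ofReal ?_
  have hle : ∫ p, f p ^ 2 * productWeight p ≤
      ∫ p, (1 / 2 * (f p ^ 2 * productWeight p) + 2 * B p) := by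
    conv_lhs => rw [integral_sq_mul_productWeight_eq hf]
    refine (neg_le_abs _).trans ((Real.norm_eq_abs _).symm.trans_le <| norm_integral_le_of_norm_le
      (g := fun p => 1 / 2 * (f p ^ 2 * productWeight p) + 2 * B p)
      ((hAi.const_mul _).add (hBi.const_mul _)) (.of_forall fun p => ?_))
    by_cases hp : p ∈ cylinder
    · simpa only [hB, Set.indicator_of_mem hp, Real.norm_eq_abs] using abs_two_mul_flux_le f hp
    · have h0 : f p = 0 := by
        by_contra h
        exact hp (hf.support_subset (subset_tsupport f h))
      simp [h0, hB, hp]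
  rw [integral_add (hAi.const_mul _) (hBi.const_mul _), integral_const_mul,
    integral_const_mul] at hle
  linarith

lemma axialEnergy_le {f : EuclideanSpace ℝ (Fin 3) → ℝ} {p : EuclideanSpace ℝ (Fin 3)}
    (hp : p ∈ cylinder) (hd : DifferentiableAt ℝ f p) :
    axialEnergy f p ≤ 16 * dualNorm cylinder p (fderiv ℝ f p) ^ 2 := by
  have hm := radialGap_pos hp
  have hc := chordGap_pos hp
  have hne : EuclideanSpace.single (0 : Fin 3) (1 : ℝ) ≠ 0 := by simp
  have h1 := abs_le_dualNorm_mul isHilbertDomain_cylinder hp (fderiv ℝ f p) hne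
  have hF := finslerNorm_pos isHilbertDomain_cylinder hp hne
  have hN : 0 ≤ dualNorm cylinder p (fderiv ℝ f p) := by
    by_contra! h
    have := mul_neg_of_neg_of_pos h hF
    linarith [abs_nonneg (fderiv ℝ f p (EuclideanSpace.single (0 : Fin 3) (1 : ℝ)))]
  have h2 := h1.trans (mul_le_mul_of_nonneg_left (finslerNorm_single_le hp) hN)
  rw [axialEnergy, hd.lineDeriv_eq_fderiv, ← sq_abs]
  have h3 := pow_le_pow_left₀ (abs_nonneg _) h2 2
  rw [mul_pow, div_pow, mul_pow, Real.sq_sqrt hc.le] at h3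
  calc _ ≤ dualNorm cylinder p (fderiv ℝ f p) ^ 2 * (4 ^ 2 * chordGap p / radialGap p ^ 2) *
        (radialGap p ^ 2 / chordGap p) := by gcongr
    _ = _ := by field_simp; norm_num

lemma lintegral_productMeasure {g : EuclideanSpace ℝ (Fin 3) → ℝ} (hg : Measurable g) :
    ∫⁻ p, ENNReal.ofReal (g p) ∂productMeasure =
      ∫⁻ p, ENNReal.ofReal (cylinder.indicator (fun p => g p * productWeight p) p) := by
  rw [productMeasure, lintegral_withDensity_eq_lintegral_mul _
    measurable_productWeight.ennreal_ofReal hg.ennreal_ofReal,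
    ← lintegral_indicator isOpen_cylinder.measurableSet]
  congr 1
  ext p
  by_cases hp : p ∈ cylinder
  · simp only [Set.indicator_of_mem hp, Pi.mul_apply]
    rw [← ENNReal.ofReal_mul (productWeight_pos hp).le, mul_comm]
  · simp [Set.indicator_of_notMem hp]

lemma indicator_sq_mul_productWeight {f : EuclideanSpace ℝ (Fin 3) → ℝ}
    (hf : IsTestFunction cylinder f) :
    cylinder.indicator (fun p => f p ^ 2 * productWeight p) =
      fun p => f p ^ 2 * productWeight p := by
  rw [Set.indicator_eq_self]
  intro p hp
  refine hf.support_subset (subset_tsupport f fun h => ?_)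
  simp [h] at hp

/-- The constant is `8 * 64 * 64`: the factor 64 = 4 · 16 from Hardy and the dual norm, and the
factors 8 and 64 from the two measure comparisons. -/
lemma le_rayleighQuotient {f : EuclideanSpace ℝ (Fin 3) → ℝ} (hf : IsTestFunction cylinder f) :
    32768⁻¹ ≤ rayleighQuotient cylinder f := by
  obtain ⟨K, hK⟩ := hf.lipschitz
  set ω := unitBallVolume 3 with hω
  have hω0 : ω ≠ 0 := unitBallVolume_ne_zero 3
  have hωt : ω ≠ ∞ := unitBallVolume_ne_top 3
  set A := ∫⁻ p, ENNReal.ofReal (f p ^ 2 * productWeight p) with hA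
  have hAe : ∫⁻ p, ENNReal.ofReal (f p ^ 2) ∂productMeasure = A := by
    rw [lintegral_productMeasure (hK.continuous.measurable.pow_const 2),
      indicator_sq_mul_productWeight hf]
  have hAi := (continuous_sq_mul_productWeight hf).integrable_of_hasCompactSupport
    (hasCompactSupport_sq_mul_productWeight hf) (μ := volume)
  have hAr := ofReal_integral_eq_lintegral_ofReal hAi
    (.of_forall (sq_mul_productWeight_nonneg hf))
  have hAt : A ≠ ∞ := by rw [hA, ← hAr]; exact ENNReal.ofReal_ne_top
  have hA0 : A ≠ 0 := by
    rw [hA, ← hAr]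
    obtain ⟨x, hx⟩ := Function.ne_iff.1 hf.ne_zero
    have hw := productWeight_pos (hf.support_subset (subset_tsupport f hx))
    refine (ENNReal.ofReal_pos.2 ?_).ne'
    exact (continuous_sq_mul_productWeight hf).integral_pos_of_hasCompactSupport_nonneg_nonzero
      (hasCompactSupport_sq_mul_productWeight hf) (sq_mul_productWeight_nonneg hf)
      (mul_ne_zero (pow_ne_zero 2 hx) hw.ne')
  have hden1 : ∫⁻ p, ENNReal.ofReal (f p ^ 2) ∂(hilbertMeasure cylinder) ≤ ω * 64 * A := by
    rw [← hAe, ← smul_eq_mul, ← lintegral_smul_measure]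
    exact lintegral_mono' hilbertMeasure_cylinder_le le_rfl
  have hden2 : ω / 8 * A ≤ ∫⁻ p, ENNReal.ofReal (f p ^ 2) ∂(hilbertMeasure cylinder) := by
    rw [← hAe, ← smul_eq_mul, ← lintegral_smul_measure]
    exact lintegral_mono' le_hilbertMeasure_cylinder le_rfl
  have hnum : ω / 8 * (64⁻¹ * A) ≤ ∫⁻ p, ENNReal.ofReal (dualNorm cylinder p (fderiv ℝ f p) ^ 2)
      ∂(hilbertMeasure cylinder) := by
    have h1 : A ≤ 4 * ∫⁻ p, ENNReal.ofReal (axialEnergy f p) ∂productMeasure := by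
      rw [lintegral_productMeasure (measurable_axialEnergy hK.continuous)]
      exact lintegral_sq_le hf
    have hac : productMeasure ≪ volume.restrict cylinder :=
      withDensity_absolutelyContinuous _ _
    have h2 : ∫⁻ p, ENNReal.ofReal (axialEnergy f p) ∂productMeasure ≤
        16 * ∫⁻ p, ENNReal.ofReal (dualNorm cylinder p (fderiv ℝ f p) ^ 2) ∂productMeasure := by
      rw [← lintegral_const_mul' _ _ (by simp)]
      refine lintegral_mono_ae (hac.ae_le ?_)
      -- Rademacher's theorem: where `f` is differentiable, the dual norm of its differential
      -- controls the axial derivative.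
      filter_upwards [ae_restrict_mem isOpen_cylinder.measurableSet,
        ae_restrict_of_ae hK.ae_differentiableAt] with p hp hd
      rw [show (16 : ℝ≥0∞) = ENNReal.ofReal 16 by simp, ← ENNReal.ofReal_mul (by norm_num)]
      exact ENNReal.ofReal_le_ofReal (axialEnergy_le hp hd)
    have h3 : 64⁻¹ * A ≤
        ∫⁻ p, ENNReal.ofReal (dualNorm cylinder p (fderiv ℝ f p) ^ 2) ∂productMeasure := by
      rw [mul_comm, ← div_eq_mul_inv]
      refine ENNReal.div_le_of_le_mul' (h1.trans ?_)
      refine (mul_le_mul_right h2 4).trans (le_of_eq ?_)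
      rw [← mul_assoc]
      norm_num
    refine (mul_le_mul_right h3 _).trans ?_
    rw [← smul_eq_mul, ← lintegral_smul_measure]
    exact lintegral_mono' le_hilbertMeasure_cylinder le_rfl
  have hd0 : ∫⁻ p, ENNReal.ofReal (f p ^ 2) ∂(hilbertMeasure cylinder) ≠ 0 := by
    refine (lt_of_lt_of_le (pos_iff_ne_zero.2 ?_) hden2).ne'
    exact mul_ne_zero (ENNReal.div_ne_zero.2 ⟨hω0, by simp⟩) hA0
  have hdt : ∫⁻ p, ENNReal.ofReal (f p ^ 2) ∂(hilbertMeasure cylinder) ≠ ∞ :=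
    (lt_of_le_of_lt hden1 (ENNReal.mul_lt_top (ENNReal.mul_lt_top hωt.lt_top (by simp))
      hAt.lt_top)).ne
  rw [rayleighQuotient, ENNReal.le_div_iff_mul_le (.inl hd0) (.inl hdt)]
  refine le_trans ?_ hnum
  calc _ ≤ 32768⁻¹ * (ω * 64 * A) := by gcongr
    _ = (32768⁻¹ * 64) * (ω * A) := by ring
    _ = (8⁻¹ * 64⁻¹) * (ω * A) := by
      congr 1
      rw [← ENNReal.mul_inv (by simp) (by simp),
        show (32768 : ℝ≥0∞) = 8 * 64 * 64 by norm_num, ENNReal.mul_inv (by simp) (by simp),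
        mul_assoc, ENNReal.inv_mul_cancel (by simp) (by simp), mul_one]
    _ = _ := by rw [div_eq_mul_inv]; ring

lemma bottomOfSpectrum_cylinder_pos : 0 < bottomOfSpectrum cylinder :=
  lt_of_lt_of_le (by simp) (le_iInf₂ fun _ hf => le_rayleighQuotient hf)

end Spectrum

/-! ### The Cheeger constant, by slicing along the first axis. -/

section Cheeger

lemma concaveOn_radialGap : ConcaveOn ℝ (closure cylinder) radialGap := by
  refine ⟨convex_cylinder.closure, fun x _ y _ a b ha hb hab => ?_⟩
  have := sq_add_sq_convex (s := x 0) (t := x 1) (u := y 0) (v := y 1) ha hb hab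
  simp only [radialGap, smul_eq_mul, PiLp.add_apply, PiLp.smul_apply]
  nlinarith

lemma concaveOn_chordGap : ConcaveOn ℝ (closure cylinder) chordGap := by
  refine ⟨convex_cylinder.closure, fun x _ y _ a b ha hb hab => ?_⟩
  have := sq_add_sq_convex (s := x 1) (t := 0) (u := y 1) (v := 0) ha hb hab
  simp only [chordGap, smul_eq_mul, PiLp.add_apply, PiLp.smul_apply]
  nlinarith

lemma concaveOn_heightGap : ConcaveOn ℝ (closure cylinder) heightGap := by
  refine ⟨convex_cylinder.closure, fun x _ y _ a b ha hb hab => ?_⟩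
  have := sq_add_sq_convex (s := x 2) (t := 0) (u := y 2) (v := 0) ha hb hab
  simp only [heightGap, smul_eq_mul, PiLp.add_apply, PiLp.smul_apply]
  nlinarith

lemma radialGap_nonneg {p : EuclideanSpace ℝ (Fin 3)} (hp : p ∈ closure cylinder) :
    0 ≤ radialGap p := by
  have := (closure_cylinder_subset hp).1
  unfold radialGap
  linarith

lemma heightGap_nonneg {p : EuclideanSpace ℝ (Fin 3)} (hp : p ∈ closure cylinder) :
    0 ≤ heightGap p := by
  have := abs_le.1 (closure_cylinder_subset hp).2
  unfold heightGap
  nlinarith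

lemma exp_le_one_add_two_mul {x : ℝ} (h0 : 0 ≤ x) (h1 : x ≤ 1) : Real.exp x ≤ 1 + 2 * x := by
  have := abs_le.1 (Real.abs_exp_sub_one_sub_id_le (x := x) (by rwa [abs_of_nonneg h0]))
  nlinarith

/-- The three gaps are nonnegative and concave, so each changes by a factor at most `e ≤ 3`; then `9
= √3 * √3 * 3`. -/
lemma fluxBound_le_of_hilbertDist_le {p q : EuclideanSpace ℝ (Fin 3)} (hp : p ∈ cylinder)
    (hq : q ∈ cylinder) (hd : hilbertDist cylinder p q ≤ 1 / 2) :
    fluxBound q ≤ 9 * fluxBound p := by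
  have hC := isHilbertDomain_cylinder
  have hE : Real.exp (2 * hilbertDist cylinder p q) ≤ 3 :=
    (Real.exp_le_exp.2 (by linarith : _ ≤ (1 : ℝ))).trans
      ((exp_le_one_add_two_mul zero_le_one le_rfl).trans (by norm_num))
  have hm := radialGap_pos hq
  have hc := chordGap_pos hq
  have hh := heightGap_pos hq
  have hmp := radialGap_pos hp
  have hcp := chordGap_pos hp
  have hhp := heightGap_pos hp
  have h1 : radialGap p ≤ 3 * radialGap q :=
    (concaveOn_le_exp_mul hC concaveOn_radialGap (fun _ => radialGap_nonneg) hp hq).trans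
      (by gcongr)
  have h2 : chordGap p ≤ 3 * chordGap q :=
    (concaveOn_le_exp_mul hC concaveOn_chordGap
      (fun x hx => (radialGap_nonneg hx).trans (radialGap_le_chordGap x)) hp hq).trans (by gcongr)
  have h3 : heightGap p ≤ 3 * heightGap q :=
    (concaveOn_le_exp_mul hC concaveOn_heightGap (fun _ => heightGap_nonneg) hp hq).trans
      (by gcongr)
  have h4 : √(chordGap p) * √(radialGap p) * heightGap p ≤
      9 * (√(chordGap q) * √(radialGap q) * heightGap q) := by
    calc _ ≤ √(3 * chordGap q) * √(3 * radialGap q) * (3 * heightGap q) := by gcongr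
      _ = (√3 * √3) * 3 * (√(chordGap q) * √(radialGap q) * heightGap q) := by
        rw [Real.sqrt_mul (by norm_num), Real.sqrt_mul (by norm_num)]; ring
      _ = _ := by rw [Real.mul_self_sqrt (by norm_num)]; norm_num
  rw [fluxBound, fluxBound, ← div_eq_mul_inv, inv_eq_one_div, div_le_div_iff₀ (by positivity)
    (by positivity)]
  linarith

/-- For `d ≤ 1/2` the Finsler norm at `p` of `q - p` is at most `4 * d`, and it dominates the Klein
norm and the interval norm. -/
lemma coord_sub_le_of_hilbertDist_le {p q : EuclideanSpace ℝ (Fin 3)} (hp : p ∈ cylinder)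
    (hq : q ∈ cylinder) {d : ℝ} (hd : hilbertDist cylinder p q ≤ d) (hd0 : 0 ≤ d)
    (hd1 : d ≤ 1 / 2) :
    |q 1 - p 1| ≤ 4 * d * (√(chordGap p) * √(radialGap p)) ∧ |q 2 - p 2| ≤ 4 * d * heightGap p := by
  have hm := radialGap_pos hp
  have hc := chordGap_pos hp
  have hh := heightGap_pos hp
  rcases eq_or_ne p q with rfl | hpq
  · simp only [sub_self, abs_zero]
    exact ⟨by positivity, by positivity⟩
  obtain ⟨σ, τ, hσ, hτ, h1, h2, hdist⟩ := exists_exitTimes isHilbertDomain_cylinder hp hq hpq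
  -- The exit points of the chord, rewritten as seen from `p` with velocity `q - p`: times `1 + τ`
  -- forward and `σ` backward.
  have e1 : p + (1 + τ) • (q - p) = q + τ • (q - p) := by module
  have e2 : p - σ • (q - p) = p + σ • (p - q) := by module
  rw [← e1] at h2
  rw [← e2] at h1
  have hK := kleinForm_le hp (by positivity) hσ h2 h1
  have hH := abs_height_le hp (by positivity) hσ h2 h1
  have hN : 1 / 2 * ((1 + τ)⁻¹ + σ⁻¹) ≤ 4 * d := by
    have hlog : Real.log ((1 + σ⁻¹) * (1 + τ⁻¹)) ≤ 2 * d := by linarith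
    rw [Real.log_le_iff_le_exp (by positivity)] at hlog
    have := exp_le_one_add_two_mul (x := 2 * d) (by linarith) (by linarith)
    have hs : 0 < σ⁻¹ := by positivity
    have ht : 0 < τ⁻¹ := by positivity
    have : (1 + τ)⁻¹ ≤ τ⁻¹ := inv_anti₀ hτ (by linarith)
    nlinarith [mul_pos hs ht]
  have hN0 : 0 ≤ 1 / 2 * ((1 + τ)⁻¹ + σ⁻¹) := by positivity
  constructor
  · have hK' : kleinForm p (q - p) ≤ (radialGap p * (4 * d)) ^ 2 :=
      hK.trans (pow_le_pow_left₀ (by positivity) (by gcongr) 2)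
    have h3 := mul_le_mul_of_nonneg_left hK' hc.le
    rw [chordGap_mul_kleinForm] at h3
    have h4 : radialGap p * (q - p) 1 ^ 2 ≤ radialGap p * (16 * d ^ 2 * (chordGap p * radialGap p))
        := by
      nlinarith [sq_nonneg (chordGap p * (q - p) 0 + p 0 * p 1 * (q - p) 1)]
    have h5 := le_of_mul_le_mul_left h4 hm
    refine abs_le_of_sq_le_sq ?_ (by positivity)
    rw [mul_pow, mul_pow _ (√_), Real.sq_sqrt hc.le, Real.sq_sqrt hm.le]
    simp only [PiLp.sub_apply] at h5
    linarith
  · rw [mul_comm]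
    exact hH.trans (by gcongr)

/-- The area, weighted by `fluxBound`, of the projection of a small set along the first axis is
controlled by the square of its Hilbert diameter. -/
lemma exists_majorant_of_hilbertDiam_le {t : Set (EuclideanSpace ℝ (Fin 3))}
    (ht : t ⊆ cylinder) (hd : hilbertDiam cylinder t ≤ ENNReal.ofReal (1 / 2)) :
    ∃ F : (Fin 2 → ℝ) → ℝ≥0∞, Measurable F ∧
      (∀ q ∈ t, ENNReal.ofReal (fluxBound q) ≤ F ![q 1, q 2]) ∧
      ∫⁻ y, F y ≤ 576 * ⨆ (_ : t.Nonempty), hilbertDiam cylinder t ^ 2 := by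
  rcases t.eq_empty_or_nonempty with rfl | hne
  · exact ⟨0, measurable_const, by simp, by simp⟩
  obtain ⟨p, hpt⟩ := hne
  have hp := ht hpt
  have hm := radialGap_pos hp
  have hc := chordGap_pos hp
  have hh := heightGap_pos hp
  have hfb := fluxBound_pos hp
  have htop : hilbertDiam cylinder t ≠ ∞ := (hd.trans_lt ENNReal.ofReal_lt_top).ne
  set d := (hilbertDiam cylinder t).toReal with hdd
  have hd0 : 0 ≤ d := ENNReal.toReal_nonneg
  have hde : hilbertDiam cylinder t = ENNReal.ofReal d := (ENNReal.ofReal_toReal htop).symm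
  have hd1 : d ≤ 1 / 2 := by
    rwa [hde, ENNReal.ofReal_le_ofReal_iff (by norm_num)] at hd
  have hdist : ∀ q ∈ t, hilbertDist cylinder p q ≤ d := by
    intro q hq
    have : ENNReal.ofReal (hilbertDist cylinder p q) ≤ ENNReal.ofReal d := by
      rw [← hde, hilbertDiam]
      exact le_iSup₂_of_le p hpt (le_iSup₂_of_le q hq le_rfl)
    rwa [ENNReal.ofReal_le_ofReal_iff hd0] at this
  set a := 4 * d * (√(chordGap p) * √(radialGap p)) with ha
  set b := 4 * d * heightGap p with hb
  have ha0 : 0 ≤ a := by positivity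
  have hb0 : 0 ≤ b := by positivity
  -- The rectangle has area `64 * d ^ 2` divided by `fluxBound p`; multiplying by the height `9 *
  -- fluxBound p` gives `576 * d ^ 2`.
  set R : Set (Fin 2 → ℝ) := Set.Icc ![p 1 - a, p 2 - b] ![p 1 + a, p 2 + b] with hR
  refine ⟨R.indicator fun _ => ENNReal.ofReal (9 * fluxBound p),
    measurable_const.indicator measurableSet_Icc, fun q hq => ?_, ?_⟩
  · have hco := coord_sub_le_of_hilbertDist_le hp (ht hq) (hdist q hq) hd0 hd1
    have h1 := abs_le.1 hco.1
    have h2 := abs_le.1 hco.2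
    have hmem : ![q 1, q 2] ∈ R := by
      rw [hR, Set.mem_Icc, Pi.le_def, Pi.le_def]
      simp only [Fin.forall_fin_two, Matrix.cons_val_zero, Matrix.cons_val_one]
      refine ⟨⟨?_, ?_⟩, ?_, ?_⟩ <;> linarith [h1.1, h1.2, h2.1, h2.2]
    rw [Set.indicator_of_mem hmem]
    exact ENNReal.ofReal_le_ofReal
      (fluxBound_le_of_hilbertDist_le hp (ht hq) ((hdist q hq).trans hd1))
  · rw [lintegral_indicator_const measurableSet_Icc, Real.volume_Icc_pi, Fin.prod_univ_two,
      iSup_pos ⟨p, hpt⟩, hde, ← ENNReal.ofReal_pow hd0]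
    simp only [Matrix.cons_val_zero, Matrix.cons_val_one]
    rw [← ENNReal.ofReal_mul (by linarith), ← ENNReal.ofReal_mul (by positivity),
      show (576 : ℝ≥0∞) = ENNReal.ofReal 576 by simp, ← ENNReal.ofReal_mul (by norm_num)]
    refine ENNReal.ofReal_le_ofReal (le_of_eq ?_)
    have : fluxBound p * (√(chordGap p) * √(radialGap p) * heightGap p) = 1 := by
      rw [fluxBound]
      exact inv_mul_cancel₀ (by positivity)
    calc _ = 576 * d ^ 2 * (fluxBound p * (√(chordGap p) * √(radialGap p) * heightGap p)) := by
          rw [ha, hb]; ring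
      _ = _ := by rw [this, mul_one]

/-- The point with first coordinate `x` and remaining coordinates `y`. -/
def linePoint (x : ℝ) (y : Fin 2 → ℝ) : EuclideanSpace ℝ (Fin 3) := !₂[x, y 0, y 1]

lemma lintegral_eq_lintegral_linePoint {g : EuclideanSpace ℝ (Fin 3) → ℝ≥0∞}
    (hg : Measurable g) : ∫⁻ p, g p = ∫⁻ y, ∫⁻ x, g (linePoint x y) := by
  have hmp := (PiLp.volume_preserving_toLp (Fin 3)).comp
    (volume_preserving_piFinSuccAbove (fun _ : Fin 3 => ℝ) 0).symm
  rw [← hmp.lintegral_comp hg, Measure.volume_eq_prod, lintegral_prod_symm']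
  · congr 1 with y
    congr 1 with x
    congr 1
    ext i
    fin_cases i <;> rfl
  · exact hg.comp hmp.measurable

lemma continuous_linePoint (y : Fin 2 → ℝ) : Continuous fun x => linePoint x y := by
  refine (PiLp.continuous_toLp 2 _).comp (continuous_pi fun i => ?_)
  fin_cases i <;> simp <;> fun_prop

lemma hasDerivAt_flux_linePoint {x : ℝ} {y : Fin 2 → ℝ} (h : linePoint x y ∈ cylinder) :
    HasDerivAt (fun x => flux (linePoint x y)) (productWeight (linePoint x y)) x := by
  have h1 := hasLineDerivAt_flux h
  unfold HasLineDerivAt at h1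
  -- The derivative at `t = 0` is moved to `z = x` by the substitution `t = z - x`.
  rw [← sub_self x] at h1
  have h2 := h1.comp_sub_const x x
  refine h2.congr_of_eventuallyEq (.of_forall fun z => ?_)
  simp only
  congr 1
  ext i
  fin_cases i <;> simp [linePoint]

lemma linePoint_mem_cylinder_of_mem_Icc (y : Fin 2 → ℝ) {a b x : ℝ}
    (ha : linePoint a y ∈ cylinder) (hb : linePoint b y ∈ cylinder) (hx : x ∈ Set.Icc a b) :
    linePoint x y ∈ cylinder := by
  refine ⟨?_, by simpa [linePoint] using ha.2⟩
  have h1 := ha.1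
  have h2 := hb.1
  simp [linePoint] at h1 h2 ⊢
  rcases le_total 0 x with h | h
  · nlinarith [hx.1, hx.2]
  · nlinarith [hx.1, hx.2]

/-- The fundamental theorem of calculus for `flux` on the chord, whose convexity keeps the whole
segment in the cylinder. -/
lemma lintegral_productWeight_linePoint_le (y : Fin 2 → ℝ) {a b : ℝ} (hab : a ≤ b)
    (ha : linePoint a y ∈ cylinder) (hb : linePoint b y ∈ cylinder) :
    ∫⁻ x in Set.Ioc a b, ENNReal.ofReal (productWeight (linePoint x y)) ≤
      ENNReal.ofReal (fluxBound (linePoint b y)) + ENNReal.ofReal (fluxBound (linePoint a y)) := by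
  have hmem := fun {x} => linePoint_mem_cylinder_of_mem_Icc y (x := x) ha hb
  have hcont : ContinuousOn (fun x => productWeight (linePoint x y)) (Set.Icc a b) :=
    continuousOn_productWeight.comp (continuous_linePoint y).continuousOn fun x hx => hmem hx
  have hint : IntervalIntegrable (fun x => productWeight (linePoint x y)) volume a b :=
    ContinuousOn.intervalIntegrable (by rwa [Set.uIcc_of_le hab])
  have hftc := intervalIntegral.integral_eq_sub_of_hasDerivAt (a := a) (b := b)
    (fun x hx => hasDerivAt_flux_linePoint (hmem (by rwa [Set.uIcc_of_le hab] at hx))) hint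
  rw [intervalIntegral.integral_of_le hab] at hftc
  rw [← ofReal_integral_eq_lintegral_ofReal hint.1, hftc,
    ← ENNReal.ofReal_add (fluxBound_pos hb).le (fluxBound_pos ha).le]
  · refine ENNReal.ofReal_le_ofReal ?_
    linarith [(abs_le.1 (abs_flux_le ha)).1, (abs_le.1 (abs_flux_le hb)).2]
  · filter_upwards [ae_restrict_mem measurableSet_Ioc] with x hx
    exact (productWeight_pos (hmem ⟨hx.1.le, hx.2⟩)).le

lemma csSup_notMem_of_isOpen {V : Set ℝ} (hV : IsOpen V) (hb : BddAbove V) : sSup V ∉ V := by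
  intro h
  obtain ⟨ε, hε, hball⟩ := Metric.isOpen_iff.1 hV _ h
  have : sSup V + ε / 2 ∈ V := hball (by
    rw [Metric.mem_ball, Real.dist_eq, add_sub_cancel_left, abs_of_pos (half_pos hε)]
    exact half_lt_self hε)
  linarith [le_csSup hb this]

lemma csInf_notMem_of_isOpen {V : Set ℝ} (hV : IsOpen V) (hb : BddBelow V) : sInf V ∉ V := by
  intro h
  obtain ⟨ε, hε, hball⟩ := Metric.isOpen_iff.1 hV _ h
  have : sInf V - ε / 2 ∈ V := hball (by
    rw [Metric.mem_ball, Real.dist_eq, sub_sub_cancel_left, abs_neg, abs_of_pos (half_pos hε)]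
    exact half_lt_self hε)
  linarith [csInf_le hb this]

/-- Only the first and the last boundary point on each line are needed to bound the measure. -/
lemma lintegral_indicator_linePoint_le {U : Set (EuclideanSpace ℝ (Fin 3))}
    (hU : IsCheegerDomain cylinder U) {F : (Fin 2 → ℝ) → ℝ≥0∞}
    (hF : ∀ q ∈ frontier U, ENNReal.ofReal (fluxBound q) ≤ F ![q 1, q 2]) (y : Fin 2 → ℝ) :
    ∫⁻ x, U.indicator (fun p => ENNReal.ofReal (productWeight p)) (linePoint x y) ≤ 2 * F y := by
  set V := (fun x => linePoint x y) ⁻¹' U with hV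
  have hVo : IsOpen V := hU.isOpen.preimage (continuous_linePoint y)
  have hfun : (fun x => U.indicator (fun p => ENNReal.ofReal (productWeight p)) (linePoint x y)) =
      V.indicator fun x => ENNReal.ofReal (productWeight (linePoint x y)) := rfl
  rw [hfun, lintegral_indicator hVo.measurableSet]
  rcases V.eq_empty_or_nonempty with hVe | hVne
  · simp [hVe]
  have hVC : ∀ x ∈ V, |x| ≤ 1 := by
    intro x hx
    have := (hU.closure_subset (subset_closure hx)).1
    simp [linePoint] at this
    refine abs_le_one_iff_mul_self_le_one.2 ?_
    nlinarith [sq_nonneg (y 0)]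
  have hbb : BddBelow V := ⟨-1, fun x hx => (abs_le.1 (hVC x hx)).1⟩
  have hba : BddAbove V := ⟨1, fun x hx => (abs_le.1 (hVC x hx)).2⟩
  have hcl : ∀ x ∈ closure V, linePoint x y ∈ closure U := fun x hx =>
    map_mem_closure (f := fun x => linePoint x y) (continuous_linePoint y) hx fun _ h => h
  have hfr : ∀ x ∈ closure V, x ∉ V → linePoint x y ∈ frontier U := fun x hx hxV => by
    rw [hU.isOpen.frontier_eq]
    exact ⟨hcl x hx, hxV⟩
  have ha := csInf_mem_closure hVne hbb
  have hb := csSup_mem_closure hVne hba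
  have haV := csInf_notMem_of_isOpen hVo hbb
  have hbV := csSup_notMem_of_isOpen hVo hba
  -- Filling all gaps of `V` between its extreme points only increases the integral, and openness
  -- puts these two points on the frontier of `U`.
  have hsub : V ⊆ Set.Ioc (sInf V) (sSup V) := fun x hx =>
    ⟨lt_of_le_of_ne (csInf_le hbb hx) fun h => haV (h ▸ hx), le_csSup hba hx⟩
  have hy : ∀ x, ![(linePoint x y) 1, (linePoint x y) 2] = y := by
    intro x
    ext i
    fin_cases i <;> simp [linePoint]
  have hFa := hF _ (hfr _ ha haV)
  have hFb := hF _ (hfr _ hb hbV)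
  rw [hy] at hFa hFb
  calc _ ≤ ∫⁻ x in Set.Ioc (sInf V) (sSup V), ENNReal.ofReal (productWeight (linePoint x y)) :=
        lintegral_mono_set hsub
    _ ≤ _ := lintegral_productWeight_linePoint_le y (csInf_le_csSup hVne hbb hba)
        (hU.closure_subset (hcl _ ha)) (hU.closure_subset (hcl _ hb))
    _ ≤ F y + F y := add_le_add hFb hFa
    _ = _ := (two_mul _).symm

lemma productMeasure_apply {U : Set (EuclideanSpace ℝ (Fin 3))}
    (hU : IsCheegerDomain cylinder U) :
    productMeasure U = ∫⁻ p in U, ENNReal.ofReal (productWeight p) := by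
  rw [productMeasure, withDensity_apply _ hU.isOpen.measurableSet,
    Measure.restrict_restrict hU.isOpen.measurableSet,
    Set.inter_eq_left.2 (subset_closure.trans hU.closure_subset)]

/-- The sum of the majorants of the pieces bounds `fluxBound` over the projection of the frontier;
integrating the line estimate then gives `1152 = 2 * 576`. -/
lemma productMeasure_le_tsum {U : Set (EuclideanSpace ℝ (Fin 3))}
    (hU : IsCheegerDomain cylinder U) {t : ℕ → Set (EuclideanSpace ℝ (Fin 3))}
    (htC : ∀ i, t i ⊆ cylinder) (hcov : frontier U ⊆ ⋃ i, t i)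
    (hd : ∀ i, hilbertDiam cylinder (t i) ≤ ENNReal.ofReal (1 / 2)) :
    productMeasure U ≤
      1152 * ∑' i, ⨆ (_ : (t i).Nonempty), hilbertDiam cylinder (t i) ^ 2 := by
  choose F hFm hF hFi using fun i => exists_majorant_of_hilbertDiam_le (htC i) (hd i)
  have hFU : ∀ q ∈ frontier U, ENNReal.ofReal (fluxBound q) ≤ ∑' i, F i ![q 1, q 2] := by
    intro q hq
    obtain ⟨i, hi⟩ := Set.mem_iUnion.1 (hcov hq)
    exact (hF i q hi).trans (ENNReal.le_tsum i)
  rw [productMeasure_apply hU, ← lintegral_indicator hU.isOpen.measurableSet,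
    lintegral_eq_lintegral_linePoint
      (measurable_productWeight.ennreal_ofReal.indicator hU.isOpen.measurableSet)]
  calc _ ≤ ∫⁻ y, 2 * ∑' i, F i y :=
        lintegral_mono fun y =>
          lintegral_indicator_linePoint_le hU (F := fun y => ∑' i, F i y) hFU y
    _ = 2 * ∑' i, ∫⁻ y, F i y := by
        rw [lintegral_const_mul' _ _ (by simp), lintegral_tsum fun i => (hFm i).aemeasurable]
    _ ≤ 2 * ∑' i, 576 * ⨆ (_ : (t i).Nonempty), hilbertDiam cylinder (t i) ^ 2 := by
        gcongr with i
        exact hFi i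
    _ = _ := by
        rw [ENNReal.tsum_mul_left, ← mul_assoc]
        norm_num

lemma productMeasure_ne_zero {U : Set (EuclideanSpace ℝ (Fin 3))}
    (hU : IsCheegerDomain cylinder U) : productMeasure U ≠ 0 := by
  rw [productMeasure_apply hU, ← pos_iff_ne_zero,
    setLIntegral_pos_iff measurable_productWeight.ennreal_ofReal,
    Set.inter_eq_right.2 fun p hp => ?_]
  · exact hU.isOpen.measure_pos _ hU.nonempty
  · exact (ENNReal.ofReal_pos.2
      (productWeight_pos (hU.closure_subset (subset_closure hp)))).ne'

lemma productMeasure_ne_top {U : Set (EuclideanSpace ℝ (Fin 3))}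
    (hU : IsCheegerDomain cylinder U) : productMeasure U ≠ ∞ := by
  obtain ⟨M, hM⟩ := hU.compact_closure.exists_bound_of_continuousOn
    (continuousOn_productWeight.mono hU.closure_subset)
  rw [productMeasure_apply hU]
  refine (lt_of_le_of_lt (setLIntegral_mono' (g := fun _ => ENNReal.ofReal M)
    hU.isOpen.measurableSet fun p hp => ENNReal.ofReal_le_ofReal
      ((le_abs_self _).trans (hM p (subset_closure hp)))) ?_).ne
  rw [setLIntegral_const]
  exact ENNReal.mul_lt_top ENNReal.ofReal_lt_top
    ((measure_mono subset_closure).trans_lt hU.compact_closure.measure_lt_top)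

lemma le_hilbertHausdorff_frontier {U : Set (EuclideanSpace ℝ (Fin 3))}
    (hU : IsCheegerDomain cylinder U) :
    unitBallVolume 2 / 2 ^ 2 * (productMeasure U / 1152) ≤
      hilbertHausdorff cylinder 2 (frontier U) := by
  rw [hilbertHausdorff]
  gcongr
  -- The supremum over scales is bounded below by the single scale 1/2, at which the estimate for
  -- small pieces applies to every cover.
  refine le_iSup₂_of_le (ENNReal.ofReal (1 / 2)) (by simp) (le_iInf₂ fun t ht => ?_)
  exact ENNReal.div_le_of_le_mul' (productMeasure_le_tsum hU ht.1 ht.2.1 ht.2.2)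

lemma cheegerConstant_cylinder_pos : 0 < cheegerConstant cylinder := by
  set κ := unitBallVolume 2 / 2 ^ 2 / 1152 with hκ
  set c := unitBallVolume 3 * 64 with hc
  have hκ0 : κ ≠ 0 := ENNReal.div_ne_zero.2
    ⟨ENNReal.div_ne_zero.2 ⟨unitBallVolume_ne_zero 2, by simp⟩, by simp⟩
  have hc0 : c ≠ 0 := mul_ne_zero (unitBallVolume_ne_zero 3) (by simp)
  have hct : c ≠ ∞ := ENNReal.mul_ne_top (unitBallVolume_ne_top 3) (by simp)
  have hpos : 0 < κ / c := ENNReal.div_pos hκ0 hct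
  refine lt_of_lt_of_le hpos (le_iInf₂ fun U hU => ?_)
  have h1 : hilbertMeasure cylinder U ≤ c * productMeasure U := hilbertMeasure_cylinder_le U
  have h2 : unitBallVolume 3 / 8 * productMeasure U ≤ hilbertMeasure cylinder U :=
    le_hilbertMeasure_cylinder U
  have h3 := le_hilbertHausdorff_frontier hU
  -- A nonzero finite denominator is what lets the quotient in `ℝ≥0∞` be cleared.
  have hne : hilbertMeasure cylinder U ≠ 0 := by
    refine (lt_of_lt_of_le (pos_iff_ne_zero.2 ?_) h2).ne'
    exact mul_ne_zero (ENNReal.div_ne_zero.2 ⟨unitBallVolume_ne_zero 3, by simp⟩)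
      (productMeasure_ne_zero hU)
  have hnt : hilbertMeasure cylinder U ≠ ∞ :=
    (lt_of_le_of_lt h1 (ENNReal.mul_lt_top hct.lt_top (productMeasure_ne_top hU).lt_top)).ne
  rw [ENNReal.le_div_iff_mul_le (.inl hne) (.inl hnt)]
  refine le_trans ?_ h3
  calc κ / c * hilbertMeasure cylinder U ≤ κ / c * (c * productMeasure U) := by gcongr
    _ = κ * productMeasure U := by rw [← mul_assoc, ENNReal.div_mul_cancel hc0 hct]
    _ = _ := by rw [hκ, div_eq_mul_inv _ (1152 : ℝ≥0∞), div_eq_mul_inv _ (1152 : ℝ≥0∞)]; ring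

end Cheeger

end HilbertGeometry

end

theorem proposition4p1 :
    HilbertGeometry.IsHilbertDomain HilbertGeometry.cylinder ∧
    0 < HilbertGeometry.cheegerConstant HilbertGeometry.cylinder ∧
    0 < HilbertGeometry.bottomOfSpectrum HilbertGeometry.cylinder ∧
    ¬ StrictConvex ℝ (closure HilbertGeometry.cylinder) ∧
    ¬ HilbertGeometry.IsGromovHyperbolic HilbertGeometry.cylinder ∧
    (¬ ∀ C : Set (EuclideanSpace ℝ (Fin 3)), HilbertGeometry.IsHilbertDomain C →
      0 < HilbertGeometry.bottomOfSpectrum C → HilbertGeometry.IsGromovHyperbolic C) ∧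
    (¬ ∀ C : Set (EuclideanSpace ℝ (Fin 3)), HilbertGeometry.IsHilbertDomain C →
      0 < HilbertGeometry.cheegerConstant C → HilbertGeometry.IsGromovHyperbolic C) :=
  ⟨HilbertGeometry.isHilbertDomain_cylinder, HilbertGeometry.cheegerConstant_cylinder_pos,
    HilbertGeometry.bottomOfSpectrum_cylinder_pos,
    HilbertGeometry.not_strictConvex_closure_cylinder,
    HilbertGeometry.not_isGromovHyperbolic_cylinder,
    fun h => HilbertGeometry.not_isGromovHyperbolic_cylinder
      (h _ HilbertGeometry.isHilbertDomain_cylinder HilbertGeometry.bottomOfSpectrum_cylinder_pos),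
    fun h => HilbertGeometry.not_isGromovHyperbolic_cylinder
      (h _ HilbertGeometry.isHilbertDomain_cylinder HilbertGeometry.cheegerConstant_cylinder_pos)⟩
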